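/- Graphs are finite and simple. For a connected graph $G$, the status of a vertex $u$ is $s_G(u)=\sum_{v\in V(G)}d_G(u,v)$, where $d_G$ is the graph distance, and the minimum status of $G$ is $s(G)=\min_{u\in V(G)}s_G(u)$. The domination number of $G$ is the least cardinality of a set $S\subseteq V(G)$ such that every vertex outside $S$ has a neighbour in $S$. For integers $p\ge q\ge 1$ with $2(p+q)\le n$, let $C_n(p,q)$ be the tree on $n$ vertices obtained from the path $v_1v_2\cdots v_{n-p-q}$ by attaching one new pendant vertex $v_i'$ to $v_i$ for each $i\in\{1,\dots,p\}\cup\{n-p-2q+1,\dots,n-p-q\}$. Theorem. Let $T$ be a tree on $n$ vertices with domination number $\gamma$, where $\lceil n/3\rceil<\gamma\le\lfloor n/2\rfloor$. Then \[ s(T)\le 3n\gamma+3\gamma-n-\left\lceil\frac{n^2+18\gamma^2}{4}\right\rceil, \] with equality if and only if $T\cong C_n\left(\left\lceil\frac{3\gamma-n}{2}\right\rceil,\left\lfloor\frac{3\gamma-n}{2}\right\rfloor\right)$. -/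

import Mathlib

namespace SimpleGraph

/-- The status `s_G(u)` of a vertex: the sum of the distances from `u` to all vertices. -/
noncomputable def status {V : Type*} [Fintype V] (G : SimpleGraph V) (u : V) : ℕ :=
  ∑ v, G.dist u v

/-- The minimum status `s(G)` of a (nonempty) graph: the minimum of `s_G(u)` over all `u`. -/
noncomputable def minStatus {V : Type*} [Fintype V] (G : SimpleGraph V) : ℕ :=
  ⨅ u, G.status u

/-- `S` is a dominating set: each vertex outside `S` is adjacent to some vertex in `S`. -/
def IsDominatingSet {V : Type*} (G : SimpleGraph V) (S : Finset V) : Prop :=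
  ∀ v, v ∉ S → ∃ u ∈ S, G.Adj v u

/-- The domination number `γ(G)`: the minimum cardinality of a dominating set. -/
noncomputable def dominationNumber {V : Type*} (G : SimpleGraph V) : ℕ :=
  sInf {k | ∃ S : Finset V, G.IsDominatingSet S ∧ S.card = k}

/-- The graph obtained from `G` by attaching one new pendant vertex `inr a` at each `a ∈ A`. -/
def attachPendants {V : Type*} (G : SimpleGraph V) (A : Set V) : SimpleGraph (V ⊕ A) where
  Adj
    | .inl u, .inl v => G.Adj u v
    | .inl u, .inr a => u = a
    | .inr a, .inl u => u = a
    | .inr _, .inr _ => False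
  symm := by
    constructor
    rintro (u | a) (v | b) h
    · exact G.adj_symm h
    · exact h
    · exact h
    · exact h
  loopless := by
    constructor
    rintro (u | a) h
    · exact G.loopless.irrefl u h
    · exact h

/-- The positions on the path `v_1 v_2 … v_{n-p-q}` at which pendant vertices are attached:
`v_i` for `i = 1, …, p` and `i = n-p-2q+1, …, n-p-q`. The vertex `v_i` is the element `i - 1`
of `Fin (n - p - q)`. -/
def caterpillarFeet (n p q : ℕ) : Set (Fin (n - p - q)) :=
  {i | (i : ℕ) + 1 ≤ p ∨ n - p - 2 * q + 1 ≤ (i : ℕ) + 1}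

/-- The caterpillar `C_n(p,q)`, of order `n` when `2 (p + q) ≤ n`. -/
def caterpillar (n p q : ℕ) : SimpleGraph (Fin (n - p - q) ⊕ caterpillarFeet n p q) :=
  (pathGraph (n - p - q)).attachPendants (caterpillarFeet n p q)

end SimpleGraph

/-- `p` is the parent map of a tree on `V` rooted at `x`, and `d` is its depth function. -/
structure ParentMap {V : Type*} (x : V) (p : V → V) (d : V → ℕ) : Prop where
  map_root : p x = x
  depth_root : d x = 0
  depth_map : ∀ v, v ≠ x → d (p v) + 1 = d v

open Classical in
/-- The set of descendants of `v` (including `v`) with respect to a parent map. -/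
noncomputable def descendants {V : Type*} [Fintype V] (p : V → V) (v : V) : Finset V :=
  {w | ∃ i, p^[i] w = v}

section ParentMap

variable {V : Type*} {x : V} {p : V → V} {d : V → ℕ}

namespace ParentMap

theorem depth_eq_zero (h : ParentMap x p d) {v : V} : d v = 0 ↔ v = x := by
  refine ⟨fun hv => ?_, fun hv => hv ▸ h.depth_root⟩
  by_contra hne
  have := h.depth_map v hne
  omega

theorem depth_map_eq (h : ParentMap x p d) (v : V) : d (p v) = d v - 1 := by
  by_cases hv : v = x
  · simp [hv, h.map_root, h.depth_root]
  · have := h.depth_map v hv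
    omega

theorem depth_iterate (h : ParentMap x p d) (i : ℕ) (v : V) : d (p^[i] v) = d v - i := by
  induction i generalizing v with
  | zero => simp
  | succ i ih => rw [Function.iterate_succ_apply, ih, h.depth_map_eq]; omega

end ParentMap

variable [Fintype V]

theorem mem_descendants {v w : V} : w ∈ descendants p v ↔ ∃ i, p^[i] w = v := by
  simp [descendants]

theorem self_mem_descendants (v : V) : v ∈ descendants p v :=
  mem_descendants.2 ⟨0, rfl⟩

theorem mem_descendants_of_map {v w : V} (h : p w ∈ descendants p v) : w ∈ descendants p v := by
  obtain ⟨i, hi⟩ := mem_descendants.1 h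
  exact mem_descendants.2 ⟨i + 1, hi⟩

theorem map_mem_descendants {v w : V} (h : w ∈ descendants p v) (hne : w ≠ v) :
    p w ∈ descendants p v := by
  obtain ⟨i, hi⟩ := mem_descendants.1 h
  cases i with
  | zero => exact absurd hi hne
  | succ i => exact mem_descendants.2 ⟨i, hi⟩

theorem descendants_trans {u v w : V} (hw : w ∈ descendants p v) (hv : v ∈ descendants p u) :
    w ∈ descendants p u := by
  obtain ⟨i, rfl⟩ := mem_descendants.1 hw
  obtain ⟨j, rfl⟩ := mem_descendants.1 hv
  exact mem_descendants.2 ⟨j + i, Function.iterate_add_apply p j i w⟩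

theorem descendants_comparable {u v w : V} (hu : w ∈ descendants p u) (hv : w ∈ descendants p v) :
    u ∈ descendants p v ∨ v ∈ descendants p u := by
  obtain ⟨i, rfl⟩ := mem_descendants.1 hu
  obtain ⟨j, rfl⟩ := mem_descendants.1 hv
  rcases le_total i j with h | h
  · exact .inl (mem_descendants.2 ⟨j - i, by
      rw [← Function.iterate_add_apply, Nat.sub_add_cancel h]⟩)
  · exact .inr (mem_descendants.2 ⟨i - j, by
      rw [← Function.iterate_add_apply, Nat.sub_add_cancel h]⟩)

namespace ParentMap

theorem mem_descendants_root (h : ParentMap x p d) (v : V) : v ∈ descendants p x :=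
  mem_descendants.2 ⟨d v, h.depth_eq_zero.1 (by rw [h.depth_iterate]; omega)⟩

theorem depth_lt (h : ParentMap x p d) {v w : V} (hw : w ∈ descendants p v) (hne : w ≠ v) :
    d v < d w := by
  have h1 : d (p w) = d w - 1 := h.depth_map_eq w
  obtain ⟨i, hi⟩ := mem_descendants.1 (map_mem_descendants hw hne)
  have h2 := h.depth_iterate i (p w)
  rw [hi] at h2
  have h3 : d w ≠ 0 := by
    intro h0
    have hwx := h.depth_eq_zero.1 h0
    have : d v = 0 := by omega
    exact hne (hwx.trans (h.depth_eq_zero.1 this).symm)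
  omega

theorem root_mem_descendants (h : ParentMap x p d) {v : V} : x ∈ descendants p v ↔ v = x := by
  refine ⟨fun hx => ?_, fun hv => hv ▸ self_mem_descendants _⟩
  by_contra hne
  have := h.depth_lt hx (Ne.symm hne)
  have := h.depth_root
  omega

open Classical in
theorem card_ancestors (h : ParentMap x p d) (w : V) :
    (Finset.univ.filter fun v => v ≠ x ∧ w ∈ descendants p v).card = d w := by
  induction hk : d w generalizing w with
  | zero =>
    rw [h.depth_eq_zero] at hk
    subst hk
    rw [Finset.card_eq_zero, Finset.filter_eq_empty_iff]
    rintro v - ⟨hv, hx⟩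
    exact hv (h.root_mem_descendants.1 hx)
  | succ k ih =>
    have hwx : w ≠ x := fun e => by rw [e, h.depth_root] at hk; omega
    have hpk : d (p w) = k := by have := h.depth_map w hwx; omega
    rw [← ih (p w) hpk]
    have : (Finset.univ.filter fun v => v ≠ x ∧ w ∈ descendants p v)
        = insert w (Finset.univ.filter fun v => v ≠ x ∧ p w ∈ descendants p v) := by
      ext v
      simp only [Finset.mem_filter, Finset.mem_univ, true_and, Finset.mem_insert]
      constructor
      · rintro ⟨hv, hw⟩
        by_cases e : v = w
        · exact .inl e
        · exact .inr ⟨hv, map_mem_descendants hw (Ne.symm e)⟩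
      · rintro (rfl | ⟨hv, hw⟩)
        · exact ⟨hwx, self_mem_descendants _⟩
        · exact ⟨hv, mem_descendants_of_map hw⟩
    rw [this, Finset.card_insert_of_notMem]
    simp only [Finset.mem_filter, Finset.mem_univ, true_and, not_and]
    intro _ hmem
    by_cases e : p w = w
    · rw [e] at hpk; omega
    · have := h.depth_lt hmem e
      omega

open Classical in
theorem sum_depth (h : ParentMap x p d) :
    ∑ w, d w = ∑ v ∈ Finset.univ.erase x, (descendants p v).card := by
  have h1 : ∀ w, d w = ∑ v ∈ Finset.univ.erase x, if w ∈ descendants p v then 1 else 0 := by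
    intro w
    rw [← h.card_ancestors w, ← Finset.card_filter]
    congr 1
    ext v
    simp
  rw [Finset.sum_congr rfl fun w _ => h1 w, Finset.sum_comm]
  refine Finset.sum_congr rfl fun v _ => ?_
  rw [Finset.card_eq_sum_ones, ← Finset.sum_filter]
  simp

/-- A proper descendant of `v` lies below a child of `v`. -/
theorem exists_child (h : ParentMap x p d) {v w : V} (hw : w ∈ descendants p v) (hne : w ≠ v) :
    ∃ c, c ≠ x ∧ p c = v ∧ w ∈ descendants p c := by
  obtain ⟨i, hi⟩ := mem_descendants.1 hw
  induction i generalizing w with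
  | zero => exact absurd hi hne
  | succ i ih =>
    by_cases e : p w = v
    · refine ⟨w, ?_, e, self_mem_descendants _⟩
      rintro rfl
      exact hne (h.map_root.symm.trans e)
    · obtain ⟨c, h1, h2, h3⟩ := ih (map_mem_descendants hw hne) e hi
      exact ⟨c, h1, h2, mem_descendants_of_map h3⟩

/-- Every vertex other than the root lies below a child of the root. -/
theorem exists_child_of_root (h : ParentMap x p d) {v : V} (hv : v ≠ x) :
    ∃ c, c ≠ x ∧ p c = x ∧ v ∈ descendants p c :=
  h.exists_child (h.mem_descendants_root v) hv

end ParentMap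

end ParentMap

namespace SimpleGraph

variable {V : Type*} {T : SimpleGraph V}

/-- In a tree the neighbour of a vertex `v` towards the root `x` is unique. -/
theorem IsTree.eq_of_adj_of_dist (hT : T.IsTree) {x v w w' : V} (hw : T.Adj v w) (hw' : T.Adj v w')
    (hd : T.dist x w + 1 = T.dist x v) (hd' : T.dist x w' + 1 = T.dist x v) : w = w' := by
  obtain ⟨W, hW⟩ := hT.connected.exists_walk_length_eq_dist x w
  obtain ⟨W', hW'⟩ := hT.connected.exists_walk_length_eq_dist x w'
  have h1 : (W.concat hw.symm).IsPath :=
    Walk.isPath_of_length_eq_dist _ (by rw [Walk.length_concat, hW, hd])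
  have h2 : (W'.concat hw'.symm).IsPath :=
    Walk.isPath_of_length_eq_dist _ (by rw [Walk.length_concat, hW', hd'])
  have := (hT.existsUnique_path x v).unique h1 h2
  have := congrArg Walk.penultimate this
  simpa using this

theorem IsTree.exists_parentMap (hT : T.IsTree) (x : V) :
    ∃ p : V → V, ParentMap x p (T.dist x) ∧ (∀ v, v ≠ x → T.Adj v (p v)) ∧
      ∀ u v, T.Adj u v → (u ≠ x ∧ p u = v) ∨ (v ≠ x ∧ p v = u) := by
  classical
  have key : ∀ v, v ≠ x → ∃ w, T.Adj v w ∧ T.dist x w + 1 = T.dist x v := by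
    intro v hv
    obtain ⟨W, hW⟩ := hT.connected.exists_walk_length_eq_dist x v
    have hnil : ¬ W.Nil := Walk.not_nil_of_ne (Ne.symm hv)
    have hadj := W.adj_penultimate hnil
    refine ⟨W.penultimate, hadj.symm, ?_⟩
    have h1 : T.dist x W.penultimate ≤ W.dropLast.length := dist_le _
    have h2 : W.dropLast.length + 1 = W.length := Walk.length_dropLast_add_one hnil
    have h3 := hT.dist_eq_dist_add_one_of_adj x hadj
    omega
  choose f hf using key
  refine ⟨fun v => if h : v = x then x else f v h, ⟨by simp, by simp, ?_⟩, ?_, ?_⟩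
  · intro v hv
    simpa [hv] using (hf v hv).2
  · intro v hv
    simpa [hv] using (hf v hv).1
  · intro u v huv
    have aux : ∀ a b, T.Adj a b → T.dist x a = T.dist x b + 1 → a ≠ x ∧
        (if h : a = x then x else f a h) = b := by
      intro a b hab hd
      have ha : a ≠ x := by rintro rfl; simp at hd
      refine ⟨ha, ?_⟩
      simp only [ha, dite_false]
      exact hT.eq_of_adj_of_dist (hf a ha).1 hab (hf a ha).2 hd.symm
    rcases hT.dist_eq_dist_add_one_of_adj x huv with h | h
    · exact .inl (aux u v huv h)
    · exact .inr (aux v u huv.symm h)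

end SimpleGraph

namespace ParentMap

open Finset

variable {V : Type*} [Fintype V] {x : V} {p : V → V} {d : V → ℕ} {K : Finset V}

theorem map_notMem (h : ParentMap x p d) (hx : x ∉ K) (hK : ∀ v ∈ K, #(descendants p v) = 1)
    {v : V} (hv : v ∈ K) : p v ∉ K := by
  intro hpv
  have hvx : v ≠ x := fun e => hx (e ▸ hv)
  have hne : v ≠ p v := fun e => by
    have := h.depth_map v hvx
    rw [← e] at this
    omega
  exact hne (card_le_one.1 (hK _ hpv).le _ (mem_descendants_of_map (self_mem_descendants _)) _
    (self_mem_descendants _))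

variable [DecidableEq V]

theorem card_le_two_mul_sdiff (h : ParentMap x p d) (hx : x ∉ K)
    (hK : ∀ v ∈ K, #(descendants p v) = 1) (hinj : Set.InjOn p K) {S : Finset V}
    (hS : ∀ v ∈ S, v ∈ K → p v ∈ S) : #S ≤ 2 * #(S \ K) := by
  have h1 : #(S ∩ K) ≤ #(S \ K) := by
    refine card_le_card_of_injOn p ?_ (hinj.mono fun v hv => (mem_inter.1 hv).2)
    intro v hv
    obtain ⟨h1, h2⟩ := mem_inter.1 hv
    exact mem_sdiff.2 ⟨hS v h1 h2, h.map_notMem hx hK h2⟩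
  have := card_sdiff_add_card_inter S K
  omega

theorem card_add_card_le_of_disjoint {R Y Z : Finset V} {y z : V} (hYZ : Disjoint Y Z)
    (hy : y ∈ Y) (hz : z ∈ Z) (hRK : Disjoint R K) (hyK : y ∉ K) (hzK : z ∉ K)
    (hRY : ∀ v ∈ R, v ∈ Y → v = y) (hRZ : ∀ v ∈ R, v ∈ Z → v = z) :
    #R + #Y + #Z ≤ Fintype.card V + 2 ∧
      #R + #K + #(Y \ K) + #(Z \ K) ≤ Fintype.card V + 2 := by
  constructor
  · have h1 : Disjoint R (Y.erase y) := disjoint_left.2 fun v hv hv' =>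
      (mem_erase.1 hv').1 (hRY v hv (mem_erase.1 hv').2)
    have h2 : Disjoint (R ∪ Y.erase y) (Z.erase z) := by
      refine disjoint_left.2 fun v hv hv' => ?_
      obtain ⟨hne, hvZ⟩ := mem_erase.1 hv'
      rcases mem_union.1 hv with hv | hv
      · exact hne (hRZ v hv hvZ)
      · exact disjoint_left.1 hYZ (mem_erase.1 hv).2 hvZ
    have h3 := card_le_univ ((R ∪ Y.erase y) ∪ Z.erase z)
    rw [card_union_of_disjoint h2, card_union_of_disjoint h1] at h3
    have := card_erase_add_one hy
    have := card_erase_add_one hz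
    omega
  · have hyY : y ∈ Y \ K := mem_sdiff.2 ⟨hy, hyK⟩
    have hzZ : z ∈ Z \ K := mem_sdiff.2 ⟨hz, hzK⟩
    have h1 : Disjoint (R ∪ K) ((Y \ K).erase y) := by
      refine disjoint_left.2 fun v hv hv' => ?_
      obtain ⟨hne, hvY⟩ := mem_erase.1 hv'
      obtain ⟨hvY, hvK⟩ := mem_sdiff.1 hvY
      rcases mem_union.1 hv with hv | hv
      · exact hne (hRY v hv hvY)
      · exact hvK hv
    have h2 : Disjoint (R ∪ K ∪ (Y \ K).erase y) ((Z \ K).erase z) := by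
      refine disjoint_left.2 fun v hv hv' => ?_
      obtain ⟨hne, hvZ⟩ := mem_erase.1 hv'
      obtain ⟨hvZ, hvK⟩ := mem_sdiff.1 hvZ
      rcases mem_union.1 hv with hv | hv
      · rcases mem_union.1 hv with hv | hv
        · exact hne (hRZ v hv hvZ)
        · exact hvK hv
      · exact disjoint_left.1 hYZ (mem_sdiff.1 (mem_erase.1 hv).2).1 hvZ
    have h3 := card_le_univ (R ∪ K ∪ (Y \ K).erase y ∪ (Z \ K).erase z)
    rw [card_union_of_disjoint h2, card_union_of_disjoint h1, card_union_of_disjoint hRK] at h3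
    have := card_erase_add_one hyY
    have := card_erase_add_one hzZ
    omega

/-- The non-root vertices having at least `t` descendants. -/
noncomputable def large (x : V) (p : V → V) (t : ℕ) : Finset V :=
  univ.filter fun v => v ≠ x ∧ t ≤ #(descendants p v)

theorem mem_large {t : ℕ} {v : V} : v ∈ large x p t ↔ v ≠ x ∧ t ≤ #(descendants p v) := by
  simp [large]

/-- If every branch at the root has at most half of the vertices, then few vertices have at least
`t` descendants. -/
theorem card_large_le (h : ParentMap x p d) (hx : x ∉ K)
    (hK : ∀ v ∈ K, #(descendants p v) = 1) (hinj : Set.InjOn p K)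
    (hhalf : ∀ v, v ≠ x → 2 * #(descendants p v) ≤ Fintype.card V) {t : ℕ} (ht : 2 ≤ t)
    (htn : 2 * t ≤ Fintype.card V) :
    #(large x p t) + 2 * t ≤ Fintype.card V + 1 ∧
      #(large x p t) + #K + 2 * ((t + 1) / 2) ≤ Fintype.card V + 1 := by
  rcases (large x p t).eq_empty_or_nonempty with hR | hR
  · rw [hR, card_empty]
    have h1 := h.card_le_two_mul_sdiff hx hK hinj (S := univ) (by simp)
    have h2 := card_sdiff_add_card_inter univ K
    rw [univ_inter, card_univ] at h2
    rw [card_univ] at h1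
    omega
  have hxR : x ∉ large x p t := fun hmem => (mem_large.1 hmem).1 rfl
  have hlarge : ∀ v ∈ large x p t, v ∉ K := fun v hv hvK => by
    have := (mem_large.1 hv).2
    rw [hK v hvK] at this
    omega
  have hRK : Disjoint (insert x (large x p t)) K := by
    refine disjoint_left.2 fun v hv hvK => ?_
    rcases mem_insert.1 hv with rfl | hv
    · exact hx hvK
    · exact hlarge v hv hvK
  have hclosed : ∀ u ∈ large x p t, ∀ v ∈ descendants p u, v ∈ K → p v ∈ descendants p u := by
    intro u hu v hv hvK
    refine map_mem_descendants hv ?_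
    rintro rfl
    exact hlarge v hu hvK
  have finish : ∀ (Y Z : Finset V) (y z : V), Disjoint Y Z → y ∈ Y → z ∈ Z → y ∉ K → z ∉ K →
      (∀ v ∈ insert x (large x p t), v ∈ Y → v = y) →
      (∀ v ∈ insert x (large x p t), v ∈ Z → v = z) → t ≤ #Y → t ≤ #Z →
      (∀ v ∈ Y, v ∈ K → p v ∈ Y) → (∀ v ∈ Z, v ∈ K → p v ∈ Z) →
      #(large x p t) + 2 * t ≤ Fintype.card V + 1 ∧
      #(large x p t) + #K + 2 * ((t + 1) / 2) ≤ Fintype.card V + 1 := by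
    intro Y Z y z hYZ hy hz hyK hzK hRY hRZ hYt hZt hY hZ
    have h1 := card_add_card_le_of_disjoint hYZ hy hz hRK hyK hzK hRY hRZ
    have h2 := h.card_le_two_mul_sdiff hx hK hinj hY
    have h3 := h.card_le_two_mul_sdiff hx hK hinj hZ
    rw [card_insert_of_notMem hxR] at h1
    omega
  obtain ⟨y, hy, hymax⟩ := exists_max_image _ d hR
  have hxy : x ∉ descendants p y := fun hmem => (mem_large.1 hy).1 (h.root_mem_descendants.1 hmem)
  have hRY : ∀ v ∈ insert x (large x p t), v ∈ descendants p y → v = y := by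
    intro v hv hvy
    rcases mem_insert.1 hv with rfl | hv
    · exact absurd hvy hxy
    · by_contra hne
      have := h.depth_lt hvy hne
      have := hymax v hv
      omega
  by_cases hz : ∃ z ∈ large x p t, y ∉ descendants p z
  · obtain ⟨z, hz, hzmax⟩ := exists_max_image ((large x p t).filter fun z => y ∉ descendants p z) d
      (by obtain ⟨z, hz, hyz⟩ := hz; exact ⟨z, mem_filter.2 ⟨hz, hyz⟩⟩)
    obtain ⟨hz, hyz⟩ := mem_filter.1 hz
    have hxz : x ∉ descendants p z := fun hmem => (mem_large.1 hz).1 (h.root_mem_descendants.1 hmem)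
    refine finish (descendants p y) (descendants p z) y z ?_ (self_mem_descendants _)
      (self_mem_descendants _) (hlarge y hy) (hlarge z hz) hRY ?_ (mem_large.1 hy).2
      (mem_large.1 hz).2 (hclosed y hy) (hclosed z hz)
    · refine disjoint_left.2 fun v hvy hvz => ?_
      rcases descendants_comparable hvy hvz with e | e
      · exact hyz e
      · obtain rfl := hRY z (mem_insert_of_mem hz) e
        exact hyz (self_mem_descendants _)
    · intro v hv hvz
      rcases mem_insert.1 hv with rfl | hv
      · exact absurd hvz hxz
      · by_contra hne
        have h1 := h.depth_lt hvz hne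
        have h2 := hzmax v (mem_filter.2 ⟨hv, fun hyv => hyz (descendants_trans hyv hvz)⟩)
        omega
  · push Not at hz
    obtain ⟨c, hcx, hpc, hyc⟩ := h.exists_child_of_root (mem_large.1 hy).1
    have hxc : x ∉ descendants p c := fun hmem => hcx (h.root_mem_descendants.1 hmem)
    refine finish (descendants p y) (descendants p c)ᶜ y x ?_ (self_mem_descendants _)
      (mem_compl.2 hxc) (hlarge y hy) hx hRY ?_ (mem_large.1 hy).2 ?_ (hclosed y hy) ?_
    · exact disjoint_left.2 fun v hvy hvc => mem_compl.1 hvc (descendants_trans hvy hyc)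
    · intro v hv hvc
      rcases mem_insert.1 hv with rfl | hv
      · rfl
      · exfalso
        refine mem_compl.1 hvc ?_
        rcases descendants_comparable (hz v hv) hyc with e | e
        · exact e
        · by_cases hcv : c = v
          · exact hcv ▸ self_mem_descendants _
          · have h1 := h.depth_lt e hcv
            have h2 := h.depth_map c hcx
            rw [hpc, h.depth_root] at h2
            exact absurd (h.depth_eq_zero.1 (by omega)) (mem_large.1 hv).1
    · have := hhalf c hcx
      have := card_add_card_compl (descendants p c)
      omega
    · intro v hv _
      exact mem_compl.2 fun hmem => mem_compl.1 hv (mem_descendants_of_map hmem)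

/-- The sum of the depths, counted through the numbers of vertices with many descendants. -/
theorem sum_depth_eq_sum_card_large (h : ParentMap x p d) {N : ℕ}
    (hN : ∀ v, v ≠ x → #(descendants p v) ≤ N) :
    ∑ w, d w = ∑ t ∈ Icc 1 N, #(large x p t) := by
  have h1 : ∀ v ∈ univ.erase x, #(descendants p v)
      = ∑ t ∈ Icc 1 N, if t ≤ #(descendants p v) then 1 else 0 := by
    intro v hv
    rw [← card_filter]
    have : (Icc 1 N).filter (fun t => t ≤ #(descendants p v)) = Icc 1 #(descendants p v) := by
      ext t
      have := hN v (ne_of_mem_erase hv)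
      simp only [mem_filter, mem_Icc]
      omega
    rw [this, Nat.card_Icc, Nat.add_sub_cancel]
  have h2 : ∑ w, d w = ∑ v ∈ univ.erase x, #(descendants p v) := by convert h.sum_depth
  rw [h2, sum_congr rfl h1, sum_comm]
  refine sum_congr rfl fun t _ => ?_
  rw [← card_filter]
  congr 1
  ext v
  simp [mem_large]

theorem large_one : large x p 1 = univ.erase x := by
  ext v
  simp only [mem_large, mem_erase, mem_univ, and_true, and_iff_left_iff_imp]
  exact fun _ => card_pos.2 ⟨v, self_mem_descendants v⟩

end ParentMap

namespace SimpleGraph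

open Finset

variable {V : Type*} [Fintype V] {T : SimpleGraph V}

/-- Every branch at a vertex of minimum status has at most half of the vertices. -/
theorem IsTree.two_mul_card_descendants_le (hT : T.IsTree) {x : V} {p : V → V}
    (h : ParentMap x p (T.dist x)) (hadj : ∀ v, v ≠ x → T.Adj v (p v))
    (hmin : ∀ u, T.status x ≤ T.status u) {v : V} (hv : v ≠ x) :
    2 * #(descendants p v) ≤ Fintype.card V := by
  classical
  obtain ⟨c, hcx, hpc, hvc⟩ := h.exists_child_of_root hv
  have hsub : #(descendants p v) ≤ #(descendants p c) :=
    card_le_card fun w hw => descendants_trans hw hvc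
  have hcx' : T.dist c x = 1 := dist_eq_one_iff_adj.2 (hpc ▸ hadj c hcx)
  have hiter : ∀ i w, T.dist (p^[i] w) w ≤ i := by
    intro i
    induction i with
    | zero => simp
    | succ i ih =>
      intro w
      have h1 := hT.connected.dist_triangle (u := p^[i] (p w)) (v := p w) (w := w)
      have h2 : T.dist (p w) w ≤ 1 := by
        by_cases e : w = x
        · simp [e, h.map_root]
        · exact (dist_eq_one_iff_adj.2 (hadj w e).symm).le
      have := ih (p w)
      rw [Function.iterate_succ_apply]
      omega
  have hpt : ∀ w, T.dist c w + (if w ∈ descendants p c then 2 else 0) ≤ T.dist x w + 1 := by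
    intro w
    split_ifs with hw
    · obtain ⟨i, hi⟩ := mem_descendants.1 hw
      have h1 := hiter i w
      have h2 := h.depth_iterate i w
      rw [hi] at h1 h2
      rw [dist_comm, hcx'] at h2
      omega
    · have := hT.connected.dist_triangle (u := c) (v := x) (w := w)
      omega
  have hsum := sum_le_sum fun w (_ : w ∈ univ) => hpt w
  rw [sum_add_distrib, sum_add_distrib, ← sum_filter] at hsum
  simp only [sum_const, filter_univ_mem, smul_eq_mul, card_univ, mul_one] at hsum
  have := hmin c
  simp only [status] at this
  omega

end SimpleGraph

namespace ParentMap

open Finset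

theorem sum_Ico_sub_two_mul_div_two (k : ℤ) (q : ℕ) :
    ∑ t ∈ Ico 2 (2 * (q + 1)), (k - 2 * ((t / 2 : ℕ) : ℤ)) = 2 * q * k - 2 * q * (q + 1) := by
  induction q with
  | zero => simp
  | succ q ih =>
    rw [show 2 * (q + 1 + 1) = 2 * (q + 1) + 1 + 1 by ring, sum_Ico_succ_top (by omega),
      sum_Ico_succ_top (by omega), ih, show (2 * (q + 1)) / 2 = q + 1 by omega,
      show (2 * (q + 1) + 1) / 2 = q + 1 by omega]
    push_cast
    ring

theorem le_two_mul_sum_max {k N : ℕ} (hk : 2 ≤ k) (hkN : k ≤ N) :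
    (k : ℤ) ^ 2 - 2 * k ≤
      2 * ∑ t ∈ Icc 1 N, if 2 ≤ t then max 0 ((k : ℤ) - 2 * ((t / 2 : ℕ) : ℤ)) else 0 := by
  have key : ∀ q : ℕ, 2 * (q + 1) ≤ N + 1 → 2 * q * (k : ℤ) - 2 * q * (q + 1) ≤
      ∑ t ∈ Icc 1 N, if 2 ≤ t then max 0 ((k : ℤ) - 2 * ((t / 2 : ℕ) : ℤ)) else 0 := by
    intro q hq
    rw [← sum_Ico_sub_two_mul_div_two]
    calc _ ≤ ∑ t ∈ Ico 2 (2 * (q + 1)),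
          (if 2 ≤ t then max 0 ((k : ℤ) - 2 * ((t / 2 : ℕ) : ℤ)) else 0) := by
          refine sum_le_sum fun t ht => ?_
          rw [if_pos (mem_Ico.1 ht).1]
          exact le_max_right _ _
      _ ≤ _ := by
          refine sum_le_sum_of_subset_of_nonneg (fun t ht => ?_) fun t _ _ => ?_
          · rw [mem_Ico] at ht
            rw [mem_Icc]
            omega
          · split_ifs
            · exact le_max_left _ _
            · exact le_rfl
  obtain ⟨q, rfl | rfl⟩ := Nat.even_or_odd' k
  · have := key (q - 1) (by omega)
    rw [Nat.cast_sub (by omega)] at this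
    push_cast at this ⊢
    nlinarith
  · have := key q (by omega)
    push_cast at this ⊢
    nlinarith

theorem sum_Icc_bound (n N : ℕ) :
    ∑ t ∈ Icc 1 N, ((n : ℤ) + 1 - 2 * t) = N * (n - N) := by
  induction N with
  | zero => simp
  | succ N ih =>
    rw [sum_Icc_succ_top (by omega), ih]
    push_cast
    ring

variable {V : Type*} [Fintype V] [DecidableEq V] {x : V} {p : V → V} {d : V → ℕ} {K : Finset V}

theorem four_mul_sum_depth_le (h : ParentMap x p d) (hx : x ∉ K)
    (hK : ∀ v ∈ K, #(descendants p v) = 1) (hinj : Set.InjOn p K)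
    (hhalf : ∀ v, v ≠ x → 2 * #(descendants p v) ≤ Fintype.card V)
    (hk : 3 ≤ #K) (hkn : 2 * #K ≤ Fintype.card V) :
    4 * ((∑ w, d w : ℕ) : ℤ) ≤ (Fintype.card V : ℤ) ^ 2 - 2 * (#K : ℤ) ^ 2 + 4 * #K ∧
      ((Fintype.card V : ℤ) ^ 2 - 2 * (#K : ℤ) ^ 2 + 4 * #K < 4 * ((∑ w, d w : ℕ) : ℤ) + 4 →
        #(large x p 2) + #K + 1 = Fintype.card V ∧ #(large x p 3) + #K + 3 = Fintype.card V) := by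
  set n := Fintype.card V with hn
  set k := #K with hkdef
  set N := n / 2 with hN
  set B : ℕ → ℤ := fun t => ((n : ℤ) + 1 - 2 * t) -
    (if 2 ≤ t then max 0 ((k : ℤ) - 2 * ((t / 2 : ℕ) : ℤ)) else 0) with hB
  have hcB : ∀ t ∈ Icc 1 N, (#(large x p t) : ℤ) ≤ B t := by
    intro t ht
    rw [mem_Icc] at ht
    by_cases h2 : 2 ≤ t
    · have := h.card_large_le hx hK hinj hhalf h2 (by omega)
      simp only [hB, if_pos h2]
      omega
    · obtain rfl : t = 1 := by omega
      have : #(large x p 1) = n - 1 := by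
        rw [large_one, card_erase_of_mem (mem_univ _), card_univ]
      simp only [hB, if_neg h2]
      omega
  have hsumB : 4 * ∑ t ∈ Icc 1 N, B t ≤ (n : ℤ) ^ 2 - 2 * (k : ℤ) ^ 2 + 4 * k := by
    simp only [hB]
    rw [sum_sub_distrib, sum_Icc_bound]
    have h1 := le_two_mul_sum_max (k := k) (N := N) (by omega) (by omega)
    nlinarith [sq_nonneg ((n : ℤ) - 2 * N)]
  have hsum : ((∑ w, d w : ℕ) : ℤ) = ∑ t ∈ Icc 1 N, (#(large x p t) : ℤ) := by
    rw [h.sum_depth_eq_sum_card_large (N := N) fun v hv => by have := hhalf v hv; omega]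
    push_cast
    rfl
  have hle := sum_le_sum hcB
  refine ⟨by rw [hsum]; linarith, fun hlt => ?_⟩
  have heq : ∑ t ∈ Icc 1 N, (#(large x p t) : ℤ) = ∑ t ∈ Icc 1 N, B t := by
    rw [hsum] at hlt
    omega
  have heq' := (sum_eq_sum_iff_of_le hcB).1 heq
  have h2 := heq' 2 (mem_Icc.2 (by omega))
  have h3 := heq' 3 (mem_Icc.2 (by omega))
  simp only [hB] at h2 h3
  norm_num at h2 h3
  omega

end ParentMap

namespace SimpleGraph

open Finset

variable {V : Type*} {T : SimpleGraph V}

/-- `u` is the only neighbour of `l`. -/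
def IsLeafAt (T : SimpleGraph V) (l u : V) : Prop :=
  T.Adj l u ∧ ∀ w, T.Adj l w → w = u

theorem dominationNumber_le {S : Finset V} (hS : T.IsDominatingSet S) :
    T.dominationNumber ≤ #S :=
  Nat.sInf_le ⟨S, hS, rfl⟩

variable [Fintype V]

open Classical in
/-- The vertices that are adjacent to a leaf. -/
noncomputable def supportVertices (T : SimpleGraph V) : Finset V :=
  {u | ∃ l, T.IsLeafAt l u}

theorem mem_supportVertices {u : V} : u ∈ T.supportVertices ↔ ∃ l, T.IsLeafAt l u := by
  simp [supportVertices]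

theorem IsTree.three_mul_dominationNumber_le (hT : T.IsTree) (hV : 2 ≤ Fintype.card V) :
    3 * T.dominationNumber ≤ Fintype.card V + #T.supportVertices := by
  classical
  have : Nontrivial V := Fintype.one_lt_card_iff_nontrivial.1 hV
  obtain ⟨l, hl⟩ := hT.exists_vert_degree_one_of_nontrivial
  obtain ⟨r, hlr, hr⟩ := degree_eq_one_iff_existsUnique_adj.1 hl
  have hrS : r ∈ T.supportVertices := mem_supportVertices.2 ⟨l, hlr, hr⟩
  obtain ⟨p, h, hadj, hcases⟩ := hT.exists_parentMap r
  set D : ℕ → Finset V := fun a => univ.filter (fun v => T.dist r v % 3 = a) ∪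
    T.supportVertices.filter (fun u => (T.dist r u + 2) % 3 = a) with hD
  have hdom : ∀ a < 3, T.IsDominatingSet (D a) := by
    intro a ha v hv
    simp only [hD, mem_union, mem_filter, mem_univ, true_and, not_or, not_and] at hv ⊢
    by_cases hvr : v = r
    · subst hvr
      have h1 := hv.1
      have h2 := hv.2 hrS
      rw [T.dist_self] at h1 h2
      have hl1 : T.dist v l = 1 := dist_eq_one_iff_adj.2 hlr.symm
      exact ⟨l, .inl (by omega), hlr.symm⟩
    have h1 := h.depth_map v hvr
    by_cases hmod : T.dist r (p v) % 3 = a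
    · exact ⟨p v, .inl hmod, hadj v hvr⟩
    by_cases hleaf : T.IsLeafAt v (p v)
    · refine ⟨p v, .inr ⟨mem_supportVertices.2 ⟨v, hleaf⟩, ?_⟩, hadj v hvr⟩
      have := hv.1
      omega
    · have : ∃ w, T.Adj v w ∧ w ≠ p v := by
        by_contra hcon
        push Not at hcon
        exact hleaf ⟨hadj v hvr, hcon⟩
      obtain ⟨w, hvw, hw⟩ := this
      rcases hcases v w hvw with ⟨-, e⟩ | ⟨hwr, e⟩
      · exact absurd e.symm hw
      · have h2 := h.depth_map w hwr
        rw [e] at h2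
        have := hv.1
        exact ⟨w, .inl (by omega), hvw⟩
  have hcard : ∀ a, #(D a) ≤ #(univ.filter fun v => T.dist r v % 3 = a) +
      #(T.supportVertices.filter fun u => (T.dist r u + 2) % 3 = a) := fun a => card_union_le _ _
  have hsum : ∀ (S : Finset V) (f : V → ℕ), #S =
      #(S.filter fun v => f v % 3 = 0) + #(S.filter fun v => f v % 3 = 1) +
        #(S.filter fun v => f v % 3 = 2) := by
    intro S f
    rw [card_eq_sum_card_fiberwise (f := fun v => f v % 3) (t := range 3)
      (fun v _ => by simpa using Nat.mod_lt _ (by norm_num)), sum_range_succ, sum_range_succ,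
      sum_range_one]
  have e1 := hsum univ (T.dist r)
  have e2 := hsum T.supportVertices fun u => T.dist r u + 2
  have d0 := dominationNumber_le (hdom 0 (by norm_num))
  have d1 := dominationNumber_le (hdom 1 (by norm_num))
  have d2 := dominationNumber_le (hdom 2 (by norm_num))
  have c0 := hcard 0
  have c1 := hcard 1
  have c2 := hcard 2
  rw [card_univ] at e1
  omega

/-- Leaves at distinct support vertices, seen from a vertex of minimum status. -/
theorem exists_leaves_of_parentMap {x : V} {p : V → V} (h : ParentMap x p (T.dist x))
    (hadj : ∀ v, v ≠ x → T.Adj v (p v))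
    (hhalf : ∀ v, v ≠ x → 2 * #(descendants p v) ≤ Fintype.card V) (hV : 3 ≤ Fintype.card V)
    {k : ℕ} (hk : k ≤ #T.supportVertices) :
    ∃ K : Finset V, x ∉ K ∧ (∀ v ∈ K, #(descendants p v) = 1) ∧ Set.InjOn p K ∧ #K = k := by
  classical
  obtain ⟨S, hS, hSk⟩ := exists_subset_card_eq hk
  choose! l hl using fun u (hu : u ∈ T.supportVertices) => mem_supportVertices.1 hu
  have hinj : Set.InjOn l S := by
    intro u hu v hv huv
    have h1 := (hl u (hS hu)).1
    rw [huv] at h1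
    exact (hl v (hS hv)).2 u h1
  have hx : ∀ u, ¬ T.IsLeafAt x u := by
    intro u hu
    have hsub : univ.erase x ⊆ descendants p u := by
      intro v hv
      obtain ⟨c, hcx, hpc, hvc⟩ := h.exists_child_of_root (ne_of_mem_erase hv)
      obtain rfl := hu.2 c (hpc ▸ (hadj c hcx).symm)
      exact hvc
    have h1 := card_le_card hsub
    rw [card_erase_of_mem (mem_univ _), card_univ] at h1
    have := hhalf u hu.1.ne'
    omega
  have hxK : x ∉ S.image l := by
    intro hmem
    obtain ⟨u, hu, e⟩ := mem_image.1 hmem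
    exact hx u (e ▸ hl u (hS hu))
  have hp : ∀ u ∈ S, p (l u) = u := by
    intro u hu
    have hne : l u ≠ x := fun e => hx u (e ▸ hl u (hS hu))
    exact (hl u (hS hu)).2 _ (hadj _ hne)
  refine ⟨S.image l, hxK, ?_, ?_, by rw [card_image_of_injOn hinj, hSk]⟩
  · intro v hv
    have hvx : v ≠ x := fun e => hxK (e ▸ hv)
    obtain ⟨u, hu, rfl⟩ := mem_image.1 hv
    rw [card_eq_one]
    refine ⟨l u, eq_singleton_iff_unique_mem.2 ⟨self_mem_descendants _, fun w hw => ?_⟩⟩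
    by_contra hne
    obtain ⟨c, hcx, hpc, -⟩ := h.exists_child hw hne
    have h1 := (hl u (hS hu)).2 c (hpc ▸ (hadj c hcx).symm)
    have h2 := h.depth_map c hcx
    have h3 := h.depth_map _ hvx
    rw [hp u hu] at h3
    rw [hpc, h1] at h2
    omega
  · intro v hv w hw hvw
    obtain ⟨u, hu, rfl⟩ := mem_image.1 hv
    obtain ⟨u', hu', rfl⟩ := mem_image.1 hw
    rw [hp u hu, hp u' hu'] at hvw
    rw [hvw]

end SimpleGraph

namespace ParentMap

open Finset

variable {V : Type*} [DecidableEq V] {x : V} {p : V → V} {d : V → ℕ} {K : Finset V}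

theorem card_filter_map_eq_le_one (hinj : Set.InjOn p K) (v : V) :
    #(K.filter fun w => p w = v) ≤ 1 :=
  card_le_one.2 fun _ ha _ hb => hinj (mem_filter.1 ha).1 (mem_filter.1 hb).1
    ((mem_filter.1 ha).2.trans (mem_filter.1 hb).2.symm)

variable [Fintype V]

theorem large_mono {s t : ℕ} (hst : s ≤ t) : large x p t ⊆ large x p s := fun v hv => by
  obtain ⟨h1, h2⟩ := mem_large.1 hv
  exact mem_large.2 ⟨h1, hst.trans h2⟩

theorem insert_large_two_eq (hx : x ∉ K) (hK : ∀ v ∈ K, #(descendants p v) = 1)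
    (h2 : #(large x p 2) + #K + 1 = Fintype.card V) : insert x (large x p 2) = Kᶜ := by
  have hxl : x ∉ large x p 2 := fun hmem => (mem_large.1 hmem).1 rfl
  refine eq_of_subset_of_card_le (fun v hv => ?_) ?_
  · rw [mem_compl]
    intro hvK
    rcases mem_insert.1 hv with rfl | hv
    · exact hx hvK
    · have := (mem_large.1 hv).2
      rw [hK v hvK] at this
      omega
  · rw [card_insert_of_notMem hxl, card_compl]
    omega

/-- If there are as many vertices with at least two and at least three descendants as possible,
then the root has at most two children with at least two descendants, and the other vertices have
at most one such child. -/
theorem card_children_le (h : ParentMap x p d) (hx : x ∉ K)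
    (hK : ∀ v ∈ K, #(descendants p v) = 1) (hinj : Set.InjOn p K)
    (hhalf : ∀ v, v ≠ x → 2 * #(descendants p v) ≤ Fintype.card V) (hn : 5 ≤ Fintype.card V)
    (h2 : #(large x p 2) + #K + 1 = Fintype.card V)
    (h3 : #(large x p 3) + #K + 3 = Fintype.card V) :
    #((large x p 2).filter fun w => p w = x) ≤ 2 ∧
      (∀ v ∈ large x p 3, #((large x p 2).filter fun w => p w = v) ≤ 1) ∧
      ∀ v ∈ large x p 2 \ large x p 3, #((large x p 2).filter fun w => p w = v) = 0 := by
  have hI := insert_large_two_eq hx hK h2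
  have hchild : ∀ c, c ≠ x → c ∉ large x p 2 → c ∈ K := by
    intro c hcx hc
    by_contra hcK
    have := mem_compl.2 hcK
    rw [← hI] at this
    rcases mem_insert.1 this with e | e
    · exact hcx e
    · exact hc e
  have hKdesc : ∀ c ∈ K, ∀ w ∈ descendants p c, w = c := fun c hc w hw =>
    card_le_one.1 (hK c hc).le _ hw _ (self_mem_descendants _)
  have hxl : x ∉ large x p 2 := fun hmem => (mem_large.1 hmem).1 rfl
  have hmaps : ∀ w ∈ large x p 2, p w ∈ insert x (large x p 2) := by
    intro w hw
    by_cases e : p w = x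
    · exact mem_insert.2 (.inl e)
    · refine mem_insert_of_mem (mem_large.2 ⟨e, (mem_large.1 hw).2.trans (card_le_card ?_)⟩)
      intro u hu
      exact descendants_trans hu (mem_descendants_of_map (self_mem_descendants _))
  have hroot : 2 ≤ #((large x p 2).filter fun w => p w = x) := by
    by_contra hlt
    have hsub : univ.erase x ⊆ (K.filter fun w => p w = x) ∪
        ((large x p 2).filter fun w => p w = x).biUnion (descendants p) := by
      intro v hv
      obtain ⟨c, hcx, hpc, hvc⟩ := h.exists_child_of_root (ne_of_mem_erase hv)
      by_cases hc : c ∈ large x p 2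
      · exact mem_union_right _ (mem_biUnion.2 ⟨c, mem_filter.2 ⟨hc, hpc⟩, hvc⟩)
      · have hcK := hchild c hcx hc
        obtain rfl := hKdesc c hcK v hvc
        exact mem_union_left _ (mem_filter.2 ⟨hcK, hpc⟩)
    have h4 := (card_le_card hsub).trans (card_union_le _ _)
    have h5 := card_filter_map_eq_le_one hinj x
    have h6 := card_biUnion_le_card_mul ((large x p 2).filter fun w => p w = x) (descendants p)
      (Fintype.card V / 2) fun c hc => by
        have := hhalf c (mem_large.1 (mem_filter.1 hc).1).1
        omega
    have h7 : #((large x p 2).filter fun w => p w = x) * (Fintype.card V / 2) ≤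
        1 * (Fintype.card V / 2) := Nat.mul_le_mul_right _ (by omega)
    rw [card_erase_of_mem (mem_univ _), card_univ] at h4
    omega
  have hone : ∀ v ∈ large x p 3, 1 ≤ #((large x p 2).filter fun w => p w = v) := by
    intro v hv
    by_contra hlt
    have hempty : ((large x p 2).filter fun w => p w = v) = ∅ := card_eq_zero.1 (by omega)
    have hsub : (descendants p v).erase v ⊆ K.filter fun w => p w = v := by
      intro w hw
      obtain ⟨hne, hw⟩ := mem_erase.1 hw
      obtain ⟨c, hcx, hpc, hwc⟩ := h.exists_child hw hne
      have hc : c ∉ large x p 2 := fun hc => by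
        have : c ∈ (large x p 2).filter fun w => p w = v := mem_filter.2 ⟨hc, hpc⟩
        rw [hempty] at this
        exact notMem_empty _ this
      have hcK := hchild c hcx hc
      obtain rfl := hKdesc c hcK w hwc
      exact mem_filter.2 ⟨hcK, hpc⟩
    have h4 := (card_le_card hsub).trans (card_filter_map_eq_le_one hinj v)
    have h5 := (mem_large.1 hv).2
    rw [card_erase_of_mem (self_mem_descendants _)] at h4
    omega
  have hsum := card_eq_sum_card_fiberwise (f := p) (s := large x p 2) (t := insert x (large x p 2))
    hmaps
  have hsub : large x p 3 ⊆ large x p 2 := large_mono (by norm_num)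
  rw [sum_insert hxl, ← sum_sdiff hsub] at hsum
  have hge : #(large x p 3) ≤ ∑ v ∈ large x p 3, #((large x p 2).filter fun w => p w = v) := by
    rw [card_eq_sum_ones]
    exact sum_le_sum hone
  refine ⟨by omega, ?_, ?_⟩
  · intro v hv
    by_contra hlt
    have : #(large x p 3) < ∑ v ∈ large x p 3, #((large x p 2).filter fun w => p w = v) := by
      rw [card_eq_sum_ones]
      exact sum_lt_sum hone ⟨v, hv, by omega⟩
    omega
  · intro v hv
    have hzero : ∑ v ∈ large x p 2 \ large x p 3, #((large x p 2).filter fun w => p w = v) = 0 := by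
      omega
    exact sum_eq_zero_iff.1 hzero v hv

end ParentMap

namespace SimpleGraph

open Finset

variable {V : Type*} {T : SimpleGraph V}

/-- A tree whose vertices outside a set `K` of leaves at distinct vertices form a path arises by
attaching pendant vertices to a path. -/
theorem exists_iso_attachPendants {K : Finset V} {p : V → V} (hK : ∀ l ∈ K, T.IsLeafAt l (p l))
    (hpK : ∀ l ∈ K, p l ∉ K) (hinj : Set.InjOn p K) {m : ℕ} {f : Fin m → V} (hf : f.Injective)
    (hfK : ∀ i, f i ∉ K) (hsurj : ∀ v ∉ K, ∃ i, f i = v)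
    (hadj : ∀ i j, T.Adj (f i) (f j) ↔ (pathGraph m).Adj i j) :
    ∃ A : Set (Fin m), Nonempty (T ≃g (pathGraph m).attachPendants A) := by
  let A : Set (Fin m) := {j | ∃ l ∈ K, p l = f j}
  choose g hgK hg using fun a : A => a.2
  have hleaf : ∀ (a : A) v, T.Adj v (g a) ↔ v = f a := fun a v => by
    rw [← hg a]
    refine ⟨fun e => (hK _ (hgK a)).2 v e.symm, ?_⟩
    rintro rfl
    exact (hK _ (hgK a)).1.symm
  let F : Fin m ⊕ A → V := Sum.elim f g
  have hF : F.Bijective := by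
    constructor
    · rintro (i | a) (j | b) hij
      · exact congrArg _ (hf hij)
      · exact absurd (hgK b) ((show f i = g b from hij) ▸ hfK i)
      · exact absurd (hgK a) ((show g a = f j from hij) ▸ hfK j)
      · have e : g a = g b := hij
        have e1 : f a = f b := by rw [← hg a, ← hg b, e]
        exact congrArg _ (Subtype.ext (hf e1))
    · intro v
      by_cases hv : v ∈ K
      · obtain ⟨j, hj⟩ := hsurj _ (hpK v hv)
        let a : A := ⟨j, v, hv, hj.symm⟩
        exact ⟨.inr a, hinj (hgK a) hv ((hg a).trans hj)⟩
      · obtain ⟨i, hi⟩ := hsurj v hv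
        exact ⟨.inl i, hi⟩
  refine ⟨A, ⟨(RelIso.symm ⟨Equiv.ofBijective F hF, ?_⟩ :
    T ≃g (pathGraph m).attachPendants A)⟩⟩
  rintro (i | a) (j | b)
  · exact hadj i j
  · exact (hleaf b (f i)).trans hf.eq_iff
  · exact (T.adj_comm _ _).trans ((hleaf a (f j)).trans hf.eq_iff)
  · refine iff_of_false (fun e => ?_) id
    exact hfK b (((hleaf b (g a)).1 e) ▸ hgK a)

variable [Fintype V] [DecidableEq V]

/-- A tree in which the vertices outside a set `K` of leaves have at most two neighbours outside
`K`, one of them having at most one, has these vertices lying on a path. -/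
theorem IsTree.exists_path_enumeration [DecidableRel T.Adj] (hT : T.IsTree) {K : Finset V}
    (hK : ∀ l ∈ K, ∃ u, T.IsLeafAt l u) (h2 : ∀ v ∉ K, #(Kᶜ.filter fun w => T.Adj v w) ≤ 2)
    {a : V} (ha : a ∉ K) (h1 : #(Kᶜ.filter fun w => T.Adj a w) ≤ 1) {m : ℕ} (hm : #Kᶜ = m) :
    ∃ f : Fin m → V, f.Injective ∧ (∀ i, f i ∉ K) ∧ (∀ v ∉ K, ∃ i, f i = v) ∧
      ∀ i j, T.Adj (f i) (f j) ↔ (pathGraph m).Adj i j := by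
  obtain ⟨q, h, hadj, hcases⟩ := hT.exists_parentMap a
  set d := T.dist a with hd
  have hq : ∀ v, v ∉ K → v ≠ a → q v ∉ K := by
    intro v hv hva hqv
    obtain ⟨u, -, hu⟩ := hK _ hqv
    have hqa : q v ≠ a := fun e => ha (e ▸ hqv)
    have e1 := hu v (hadj v hva).symm
    have e2 := hu (q (q v)) (hadj _ hqa)
    have h1 := h.depth_map v hva
    have h2 := h.depth_map _ hqa
    rw [e2, ← e1] at h2
    omega
  have hinj : ∀ k, ∀ u ∉ K, ∀ v ∉ K, d u = k → d v = k → u = v := by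
    intro k
    induction k with
    | zero =>
      intro u _ v _ hu hv
      exact (h.depth_eq_zero.1 hu).trans (h.depth_eq_zero.1 hv).symm
    | succ k ih =>
      intro u hu v hv hdu hdv
      have hua : u ≠ a := fun e => by rw [h.depth_eq_zero.2 e] at hdu; omega
      have hva : v ≠ a := fun e => by rw [h.depth_eq_zero.2 e] at hdv; omega
      have e1 := h.depth_map u hua
      have e2 := h.depth_map v hva
      have e3 := ih (q u) (hq u hu hua) (q v) (hq v hv hva) (by omega) (by omega)
      by_contra hne
      have mu : u ∈ Kᶜ.filter fun w => T.Adj (q u) w :=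
        mem_filter.2 ⟨mem_compl.2 hu, (hadj u hua).symm⟩
      have mv : v ∈ Kᶜ.filter fun w => T.Adj (q u) w :=
        mem_filter.2 ⟨mem_compl.2 hv, e3 ▸ (hadj v hva).symm⟩
      by_cases hqa : q u = a
      · rw [hqa] at mu mv
        exact hne (card_le_one.1 h1 _ mu _ mv)
      · have e4 := h.depth_map _ hqa
        have mw : q (q u) ∈ Kᶜ.filter fun w => T.Adj (q u) w :=
          mem_filter.2 ⟨mem_compl.2 (hq _ (hq u hu hua) hqa), hadj _ hqa⟩
        have hlt : 2 < #(Kᶜ.filter fun w => T.Adj (q u) w) :=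
          two_lt_card.2 ⟨u, mu, v, mv, _, mw, hne, fun e => by rw [← e] at e4; omega,
            fun e => by rw [← e] at e4; omega⟩
        have := h2 _ (hq u hu hua)
        omega
  have hinjOn : Set.InjOn d (Kᶜ : Finset V) := fun u hu v hv huv =>
    hinj _ u (mem_compl.1 hu) v (mem_compl.1 hv) huv rfl
  have hdown : ∀ k, ∀ v ∉ K, d v = k → range (k + 1) ⊆ Kᶜ.image d := by
    intro k
    induction k with
    | zero =>
      intro v hv hdv j hj
      rw [mem_range] at hj
      exact mem_image.2 ⟨v, mem_compl.2 hv, by omega⟩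
    | succ k ih =>
      intro v hv hdv j hj
      have hva : v ≠ a := fun e => by rw [h.depth_eq_zero.2 e] at hdv; omega
      have e1 := h.depth_map v hva
      rw [mem_range] at hj
      by_cases hjk : j = k + 1
      · exact mem_image.2 ⟨v, mem_compl.2 hv, by omega⟩
      · exact ih (q v) (hq v hv hva) (by omega) (mem_range.2 (by omega))
  have hlt : ∀ v ∉ K, d v < m := by
    intro v hv
    have := card_le_card (hdown _ v hv rfl)
    rw [card_range, card_image_of_injOn hinjOn, hm] at this
    omega
  have himage : Kᶜ.image d = range m := by
    refine eq_of_subset_of_card_le (fun j hj => ?_) ?_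
    · obtain ⟨v, hv, rfl⟩ := mem_image.1 hj
      exact mem_range.2 (hlt v (mem_compl.1 hv))
    · rw [card_range, card_image_of_injOn hinjOn, hm]
  have hex : ∀ i : Fin m, ∃ v, v ∉ K ∧ d v = i := by
    intro i
    have : (i : ℕ) ∈ Kᶜ.image d := himage ▸ mem_range.2 i.2
    obtain ⟨v, hv, e⟩ := mem_image.1 this
    exact ⟨v, mem_compl.1 hv, e⟩
  choose f hfK hfd using hex
  have hstep : ∀ i j : Fin m, (i : ℕ) + 1 = j → T.Adj (f i) (f j) := by
    intro i j hij
    have hja : f j ≠ a := fun e => by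
      have := hfd j
      rw [h.depth_eq_zero.2 e] at this
      omega
    have e1 := h.depth_map _ hja
    rw [hfd] at e1
    have e2 := hinj i (q (f j)) (hq _ (hfK j) hja) (f i) (hfK i) (by omega) (hfd i)
    rw [← e2]
    exact (hadj _ hja).symm
  refine ⟨f, fun i j hij => Fin.ext ?_, hfK, fun v hv => ⟨⟨d v, hlt v hv⟩, ?_⟩, fun i j => ?_⟩
  · rw [← hfd, ← hfd, hij]
  · exact hinj (d v) _ (hfK _) v hv (hfd _) rfl
  · rw [pathGraph_adj]
    constructor
    · intro hij
      have : d (f i) = d (f j) + 1 ∨ d (f j) = d (f i) + 1 :=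
        hT.dist_eq_dist_add_one_of_adj a hij
      have e1 := hfd i
      have e2 := hfd j
      omega
    · rintro (e | e)
      · exact hstep i j e
      · exact (hstep j i e).symm

/-- A tree with as many vertices with at least two and at least three descendants as possible
arises by attaching pendant vertices to a path. -/
theorem IsTree.exists_iso_attachPendants (hT : T.IsTree) {x : V} {p : V → V}
    (h : ParentMap x p (T.dist x)) (hadj : ∀ v, v ≠ x → T.Adj v (p v))
    (hcases : ∀ u v, T.Adj u v → (u ≠ x ∧ p u = v) ∨ (v ≠ x ∧ p v = u)) {K : Finset V}
    (hx : x ∉ K) (hK : ∀ v ∈ K, #(descendants p v) = 1) (hinj : Set.InjOn p K)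
    (hhalf : ∀ v, v ≠ x → 2 * #(descendants p v) ≤ Fintype.card V) (hn : 5 ≤ Fintype.card V)
    (h2 : #(ParentMap.large x p 2) + #K + 1 = Fintype.card V)
    (h3 : #(ParentMap.large x p 3) + #K + 3 = Fintype.card V) {m : ℕ}
    (hm : m + #K = Fintype.card V) :
    ∃ A : Set (Fin m), Nonempty (T ≃g (pathGraph m).attachPendants A) := by
  classical
  obtain ⟨c1, c2, c3⟩ := h.card_children_le hx hK hinj hhalf hn h2 h3
  have hI := ParentMap.insert_large_two_eq hx hK h2
  have hleaf : ∀ l ∈ K, T.IsLeafAt l (p l) := by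
    intro l hl
    have hlx : l ≠ x := fun e => hx (e ▸ hl)
    refine ⟨hadj l hlx, fun w hw => ?_⟩
    rcases hcases l w hw with ⟨-, e⟩ | ⟨-, e⟩
    · exact e.symm
    · have hwl : w ∈ descendants p l :=
        mem_descendants_of_map (e.symm ▸ self_mem_descendants _)
      exact absurd (card_le_one.1 (hK l hl).le _ (self_mem_descendants _) _ hwl) hw.ne
  have hnb : ∀ v, Kᶜ.filter (fun w => T.Adj v w) ⊆
      insert (p v) ((ParentMap.large x p 2).filter fun w => p w = v) := by
    intro v w hw
    obtain ⟨hwK, hvw⟩ := mem_filter.1 hw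
    rcases hcases v w hvw with ⟨-, e⟩ | ⟨hwx, e⟩
    · exact mem_insert.2 (.inl e.symm)
    · rw [← hI] at hwK
      exact mem_insert_of_mem (mem_filter.2 ⟨mem_of_mem_insert_of_ne hwK hwx, e⟩)
  have hnb' : ∀ v, #(Kᶜ.filter fun w => T.Adj v w) ≤
      #((ParentMap.large x p 2).filter fun w => p w = v) + 1 := fun v =>
    (card_le_card (hnb v)).trans (card_insert_le _ _)
  have hdeg : ∀ v ∉ K, #(Kᶜ.filter fun w => T.Adj v w) ≤ 2 := by
    intro v hv
    by_cases hvx : v = x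
    · subst hvx
      refine le_trans (card_le_card fun w hw => ?_) c1
      have hw' := hnb v hw
      rw [h.map_root] at hw'
      exact mem_of_mem_insert_of_ne hw' (mem_filter.1 hw).2.ne'
    · have := hnb' v
      have hv2 : v ∈ ParentMap.large x p 2 := by
        have := mem_compl.2 hv
        rw [← hI] at this
        exact mem_of_mem_insert_of_ne this hvx
      by_cases hv3 : v ∈ ParentMap.large x p 3
      · have := c2 v hv3
        omega
      · have := c3 v (mem_sdiff.2 ⟨hv2, hv3⟩)
        omega
  have hend : (ParentMap.large x p 2 \ ParentMap.large x p 3).Nonempty := by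
    rw [← card_pos]
    have := le_card_sdiff (ParentMap.large x p 3) (ParentMap.large x p 2)
    omega
  obtain ⟨a, ha⟩ := hend
  have haK : a ∉ K := by
    rw [← mem_compl, ← hI]
    exact mem_insert_of_mem (mem_sdiff.1 ha).1
  have hadeg : #(Kᶜ.filter fun w => T.Adj a w) ≤ 1 := by
    have h4 := hnb' a
    have h5 := c3 a ha
    omega
  obtain ⟨f, hf, hfK, hsurj, hfadj⟩ := hT.exists_path_enumeration (fun l hl => ⟨_, hleaf l hl⟩)
    hdeg haK hadeg (m := m) (by rw [card_compl]; omega)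
  exact SimpleGraph.exists_iso_attachPendants hleaf (fun l hl => h.map_notMem hx hK hl) hinj hf hfK
    hsurj hfadj

end SimpleGraph

namespace SimpleGraph

open Finset

theorem Walk.le_length_of_forall_adj {V : Type*} {G : SimpleGraph V} {f : V → ℤ}
    (hf : ∀ u v, G.Adj u v → f v ≤ f u + 1) {u v : V} (W : G.Walk u v) :
    f v - f u ≤ W.length := by
  induction W with
  | nil => simp
  | cons h W ih =>
    have := hf _ _ h
    rw [Walk.length_cons]
    push_cast
    omega

theorem Connected.le_dist_of_forall_adj {V : Type*} {G : SimpleGraph V} (hG : G.Connected)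
    {f : V → ℤ} (hf : ∀ u v, G.Adj u v → f v ≤ f u + 1) (u v : V) : f v - f u ≤ G.dist u v := by
  obtain ⟨W, hW⟩ := hG.exists_walk_length_eq_dist u v
  rw [← hW]
  exact W.le_length_of_forall_adj hf

/-- Isomorphic graphs have isomorphic graphs with pendant vertices attached. -/
def attachPendantsCongr {V W : Type*} {G : SimpleGraph V} {H : SimpleGraph W} (e : G ≃g H)
    {A : Set V} {B : Set W} (hAB : ∀ v, v ∈ A ↔ e v ∈ B) :
    G.attachPendants A ≃g H.attachPendants B where
  toEquiv := Equiv.sumCongr e.toEquiv (e.toEquiv.subtypeEquiv hAB)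
  map_rel_iff' := by
    rintro (u | a) (v | b)
    · exact e.map_rel_iff
    · exact e.injective.eq_iff
    · exact e.injective.eq_iff
    · exact Iff.rfl

/-- The reversal of a path graph. -/
def pathGraphRev (m : ℕ) : pathGraph m ≃g pathGraph m where
  toEquiv := Fin.revPerm
  map_rel_iff' := by
    intro i j
    simp only [Fin.revPerm_apply, pathGraph_adj, Fin.val_rev]
    omega

theorem Iso.dist_eq {V W : Type*} {G : SimpleGraph V} {H : SimpleGraph W} (e : G ≃g H)
    (u v : V) : H.dist (e u) (e v) = G.dist u v := by
  rw [dist_eq_sInf, dist_eq_sInf]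
  congr 1
  ext k
  constructor
  · rintro ⟨W, rfl⟩
    refine ⟨(W.map e.symm.toHom).copy (by simp) (by simp), by simp⟩
  · rintro ⟨W, rfl⟩
    exact ⟨W.map e.toHom, by simp⟩

theorem Iso.minStatus_eq {V W : Type*} [Fintype V] [Fintype W] {G : SimpleGraph V}
    {H : SimpleGraph W} (e : G ≃g H) : G.minStatus = H.minStatus := by
  have h : ∀ u, G.status u = H.status (e u) := by
    intro u
    simp only [status]
    exact Fintype.sum_equiv e.toEquiv _ _ fun v => (e.dist_eq u v).symm
  simp only [minStatus, h]
  exact e.toEquiv.surjective.iInf_comp H.status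

theorem minStatus_le {V : Type*} [Fintype V] (G : SimpleGraph V) (u : V) :
    G.minStatus ≤ G.status u :=
  ciInf_le (OrderBot.bddBelow _) u

theorem exists_status_eq_minStatus {V : Type*} [Fintype V] [Nonempty V] (G : SimpleGraph V) :
    ∃ u, G.status u = G.minStatus :=
  Nat.sInf_mem (Set.range_nonempty G.status)

section attachPendants

variable {m : ℕ} {A : Set (Fin m)}

theorem dist_inl_inl_le (hG : ((pathGraph m).attachPendants A).Connected) (i j : Fin m) :
    (((pathGraph m).attachPendants A).dist (.inl i) (.inl j) : ℤ) ≤ |(i : ℤ) - j| := by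
  have key : ∀ r : ℕ, ∀ i j : Fin m, (i : ℕ) + r = j →
      ((pathGraph m).attachPendants A).dist (.inl i) (.inl j) ≤ r := by
    intro r
    induction r with
    | zero =>
      intro i j hij
      obtain rfl : i = j := Fin.ext hij
      simp
    | succ r ih =>
      intro i j hij
      let l : Fin m := ⟨i + r, by omega⟩
      have h1 := ih i l rfl
      have h2 : ((pathGraph m).attachPendants A).dist (.inl l) (.inl j) = 1 := by
        rw [dist_eq_one_iff_adj]
        exact pathGraph_adj.2 (.inl hij)
      have := hG.dist_triangle (u := .inl i) (v := .inl l) (w := .inl j)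
      omega
  rcases le_total (i : ℕ) j with h | h
  · have := key (j - i) i j (by omega)
    have : (((j : ℕ) - i : ℕ) : ℤ) ≤ |(i : ℤ) - j| := by
      rw [abs_sub_comm]
      push_cast [h]
      exact le_abs_self _
    omega
  · have := key (i - j) j i (by omega)
    rw [dist_comm] at this
    have : (((i : ℕ) - j : ℕ) : ℤ) ≤ |(i : ℤ) - j| := by
      push_cast [h]
      exact le_abs_self _
    omega

/-- The distances from the path vertex `i` in a path with pendant vertices. -/
def pendantDist (i : Fin m) : Fin m ⊕ A → ℤ :=
  Sum.elim (fun j => |(i : ℤ) - j|) fun a => |(i : ℤ) - (a : Fin m)| + 1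

theorem pendantDist_nonneg (i : Fin m) (v : Fin m ⊕ A) : 0 ≤ pendantDist i v := by
  rcases v with v | a
  · exact abs_nonneg _
  · exact add_nonneg (abs_nonneg _) zero_le_one

theorem pendantDist_adj (i : Fin m) (u v : Fin m ⊕ A)
    (h : ((pathGraph m).attachPendants A).Adj u v) :
    pendantDist i v ≤ pendantDist i u + 1 := by
  rcases u with u | a <;> rcases v with v | b
  · have := pathGraph_adj.1 (show (pathGraph m).Adj u v from h)
    simp only [pendantDist, Sum.elim_inl]
    have h1 := abs_cases ((i : ℤ) - u)
    have h2 := abs_cases ((i : ℤ) - v)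
    omega
  · obtain rfl : u = b := h
    simp [pendantDist]
  · obtain rfl : v = a := h
    simp only [pendantDist, Sum.elim_inl, Sum.elim_inr]
    omega
  · exact h.elim

theorem status_inl_le [Fintype A] (hG : ((pathGraph m).attachPendants A).Connected) (i : Fin m) :
    (((pathGraph m).attachPendants A).status (.inl i) : ℤ) ≤
      ∑ j : Fin m, |(i : ℤ) - j| + ∑ a : A, (|(i : ℤ) - (a : Fin m)| + 1) := by
  rw [status, Fintype.sum_sum_type]
  push_cast
  refine add_le_add (sum_le_sum fun j _ => dist_inl_inl_le hG i j) (sum_le_sum fun a _ => ?_)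
  have h1 : ((pathGraph m).attachPendants A).dist (.inl (a : Fin m)) (.inr a) = 1 := by
    rw [dist_eq_one_iff_adj]
    exact (rfl : (a : Fin m) = a)
  have h2 := hG.dist_triangle (u := .inl i) (v := .inl (a : Fin m)) (w := .inr a)
  have h3 := dist_inl_inl_le hG i (a : Fin m)
  omega

theorem exists_le_status [Fintype A] (hG : ((pathGraph m).attachPendants A).Connected)
    (u : Fin m ⊕ A) : ∃ i : Fin m,
      ∑ j : Fin m, |(i : ℤ) - j| + ∑ a : A, (|(i : ℤ) - (a : Fin m)| + 1) ≤
        ((pathGraph m).attachPendants A).status u := by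
  have hsum : ∀ i : Fin m, ∑ j : Fin m, |(i : ℤ) - j| +
      ∑ a : A, (|(i : ℤ) - (a : Fin m)| + 1) = ∑ v : Fin m ⊕ A, pendantDist i v := fun i => by
    rw [Fintype.sum_sum_type]
    rfl
  have hinl : ∀ (i : Fin m) (v : Fin m ⊕ A),
      pendantDist i v ≤ ((pathGraph m).attachPendants A).dist (.inl i) v := fun i v => by
    have := hG.le_dist_of_forall_adj (pendantDist_adj i) (.inl i) v
    simpa [pendantDist] using this
  rcases u with i | a
  · refine ⟨i, ?_⟩
    rw [hsum, status]
    push_cast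
    exact sum_le_sum fun v _ => hinl i v
  · refine ⟨a, ?_⟩
    classical
    let f : Fin m ⊕ A → ℤ := fun v => if v = .inr a then 0 else pendantDist (a : Fin m) v + 1
    have hf : ∀ u v, ((pathGraph m).attachPendants A).Adj u v → f v ≤ f u + 1 := by
      intro u v huv
      have h0 : 0 ≤ pendantDist (a : Fin m) u := pendantDist_nonneg _ _
      have h1 := pendantDist_adj (a : Fin m) u v huv
      simp only [f]
      split_ifs with hv hu hu
      · omega
      · omega
      · subst hu
        rcases v with v | b
        · obtain rfl : v = a := huv
          simp [pendantDist]
        · exact huv.elim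
      · omega
    rw [hsum, status, ← Equiv.sum_comp (Equiv.swap (.inl (a : Fin m)) (.inr a))]
    push_cast
    refine sum_le_sum fun v _ => ?_
    have h1 := hG.le_dist_of_forall_adj hf (.inr a) v
    refine le_trans ?_ h1
    by_cases hv : v = .inl (a : Fin m)
    · subst hv
      simp [f, pendantDist]
    · by_cases hv' : v = .inr a
      · subst hv'
        simp [f, pendantDist]
      · rw [Equiv.swap_apply_of_ne_of_ne hv hv']
        simp [f, hv']

end attachPendants

end SimpleGraph

section EndsOfRange

open Finset

theorem two_mul_sum_range_abs (i r : ℕ) :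
    2 * ∑ j ∈ range (i + r), |(i : ℤ) - j| = i * (i + 1) + r * (r - 1) := by
  induction r with
  | zero =>
    have : ∀ s : ℕ, s ≤ i → 2 * ∑ j ∈ range s, |(i : ℤ) - j| = 2 * s * i - s * (s - 1) := by
      intro s
      induction s with
      | zero => simp
      | succ s ih =>
        intro hs
        rw [sum_range_succ, mul_add, ih (by omega), abs_of_nonneg (by omega)]
        push_cast
        ring
    rw [add_zero, this i le_rfl]
    push_cast
    ring
  | succ r ih =>
    rw [← add_assoc, sum_range_succ, mul_add, ih, abs_of_nonpos (by push_cast; omega)]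
    push_cast
    ring

theorem two_mul_sum_range_abs_of_lt {i m : ℕ} (hi : i < m) :
    2 * ∑ j ∈ range m, |(i : ℤ) - j| = 2 * i ^ 2 - 2 * (m - 1) * i + m * (m - 1) := by
  obtain ⟨r, rfl⟩ := Nat.exists_eq_add_of_le hi.le
  rw [two_mul_sum_range_abs]
  push_cast
  ring

theorem sum_range_id_int (q : ℕ) : 2 * ∑ j ∈ range q, (j : ℤ) = q * (q - 1) := by
  induction q with
  | zero => simp
  | succ q ih =>
    rw [sum_range_succ, mul_add, ih]
    push_cast
    ring

theorem sum_Ico_id_int {q m : ℕ} (hq : q ≤ m) :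
    2 * ∑ j ∈ Ico (m - q) m, (j : ℤ) = 2 * q * m - q * (q + 1) := by
  rw [sum_Ico_eq_sum_range, Nat.sub_sub_self hq]
  push_cast [hq]
  rw [sum_add_distrib, mul_add, sum_range_id_int, sum_const, card_range]
  simp only [nsmul_eq_mul]
  ring

theorem sum_ends_abs {q m : ℕ} (hq : 2 * q ≤ m) :
    ∑ a ∈ range q ∪ Ico (m - q) m, |(m : ℤ) - 1 - 2 * a| = 2 * q * (m - q) := by
  have hdisj : Disjoint (range q) (Ico (m - q) m) := by
    refine disjoint_left.2 fun a ha hb => ?_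
    rw [mem_range] at ha
    rw [mem_Ico] at hb
    omega
  rw [sum_union hdisj]
  have h1 : ∑ a ∈ range q, |(m : ℤ) - 1 - 2 * a| = ∑ a ∈ range q, ((m : ℤ) - 1 - 2 * a) :=
    sum_congr rfl fun a ha => abs_of_nonneg (by rw [mem_range] at ha; omega)
  have h2 : ∑ a ∈ Ico (m - q) m, |(m : ℤ) - 1 - 2 * a| =
      ∑ a ∈ Ico (m - q) m, (2 * (a : ℤ) - (m - 1)) :=
    sum_congr rfl fun a ha => by
      rw [mem_Ico] at ha
      rw [abs_of_nonpos (by omega)]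
      ring
  have h3 := sum_range_id_int q
  have h4 := sum_Ico_id_int (show q ≤ m by omega)
  simp only [h1, h2, sum_sub_distrib, ← mul_sum, h3, h4, sum_const, card_range, Nat.card_Ico,
    Nat.sub_sub_self (show q ≤ m by omega), nsmul_eq_mul]
  ring

/-- A set `A` whose elements are as far as possible from the middle of `range m` consists of the
two ends of `range m`. -/
theorem eq_ends_of_le_sum {m k : ℕ} {A : Finset ℕ} (hA : A ⊆ range m) (hk : #A = k) (hkm : k ≤ m)
    (hsum : 2 * (m : ℤ) * k - k ^ 2 - 3 ≤ 2 * ∑ a ∈ A, |(m : ℤ) - 1 - 2 * a|) :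
    A = range ((k + 1) / 2) ∪ Ico (m - k / 2) m ∨ A = range (k / 2) ∪ Ico (m - (k + 1) / 2) m := by
  set q := k / 2 with hq
  set B := range q ∪ Ico (m - q) m with hB
  set τ : ℤ := m - 1 - 2 * q with hτ
  have hBcard : #B = 2 * q := by
    rw [hB, card_union_of_disjoint, card_range, Nat.card_Ico]
    · omega
    · refine disjoint_left.2 fun a ha hb => ?_
      rw [mem_range] at ha
      rw [mem_Ico] at hb
      omega
  have hBsum := sum_ends_abs (q := q) (m := m) (by omega)
  rw [← hB] at hBsum
  have hBge : ∀ a ∈ B, 2 ≤ |(m : ℤ) - 1 - 2 * a| - τ := by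
    intro a ha
    rw [hB, mem_union, mem_range, mem_Ico] at ha
    have := abs_cases ((m : ℤ) - 1 - 2 * a)
    omega
  have hnB : ∀ a ∈ A, a ∉ B → |(m : ℤ) - 1 - 2 * a| - τ ≤ 0 ∧
      (-2 < |(m : ℤ) - 1 - 2 * a| - τ → a = q ∨ a = m - 1 - q) := by
    intro a ha hb
    have := mem_range.1 (hA ha)
    rw [hB, mem_union, mem_range, mem_Ico] at hb
    have := abs_cases ((m : ℤ) - 1 - 2 * a)
    omega
  have e1 : ∑ a ∈ A, (|(m : ℤ) - 1 - 2 * a| - τ) = ∑ a ∈ A, |(m : ℤ) - 1 - 2 * a| - k * τ := by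
    rw [sum_sub_distrib, sum_const, hk, nsmul_eq_mul]
  have e2 : ∑ a ∈ B, (|(m : ℤ) - 1 - 2 * a| - τ) = 2 * q * (m - q) - 2 * q * τ := by
    rw [sum_sub_distrib, sum_const, hBcard, hBsum, nsmul_eq_mul]
    push_cast
    ring
  have e3 := sum_inter_add_sum_sdiff A B fun a : ℕ => |(m : ℤ) - 1 - 2 * a| - τ
  have e4 := sum_inter_add_sum_sdiff B A fun a : ℕ => |(m : ℤ) - 1 - 2 * a| - τ
  rw [inter_comm B A] at e4
  have hslack : -1 ≤ ∑ a ∈ A \ B, (|(m : ℤ) - 1 - 2 * a| - τ) -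
      ∑ a ∈ B \ A, (|(m : ℤ) - 1 - 2 * a| - τ) := by
    have hpar : k = 2 * q ∨ k = 2 * q + 1 := by omega
    have e5 : 2 * (m : ℤ) * k - k ^ 2 - 3 ≤ 2 * (k * τ + (2 * q * (m - q) - 2 * q * τ) +
        (∑ a ∈ A \ B, (|(m : ℤ) - 1 - 2 * a| - τ) -
          ∑ a ∈ B \ A, (|(m : ℤ) - 1 - 2 * a| - τ))) := by linarith
    rcases hpar with e | e
    · rw [e, hτ] at e5
      push_cast at e5
      have e6 : -3 ≤ 2 * (∑ a ∈ A \ B, (|(m : ℤ) - 1 - 2 * a| - τ) -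
          ∑ a ∈ B \ A, (|(m : ℤ) - 1 - 2 * a| - τ)) := by linarith
      omega
    · rw [e, hτ] at e5
      push_cast at e5
      have e6 : -2 ≤ 2 * (∑ a ∈ A \ B, (|(m : ℤ) - 1 - 2 * a| - τ) -
          ∑ a ∈ B \ A, (|(m : ℤ) - 1 - 2 * a| - τ)) := by linarith
      omega
  have hAB : ∑ a ∈ A \ B, (|(m : ℤ) - 1 - 2 * a| - τ) ≤ 0 :=
    sum_nonpos fun a ha => (hnB a (mem_sdiff.1 ha).1 (mem_sdiff.1 ha).2).1
  have hBA : B \ A = ∅ := by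
    by_contra hne
    obtain ⟨b, hb⟩ := nonempty_iff_ne_empty.2 hne
    have h1 := single_le_sum (f := fun a : ℕ => |(m : ℤ) - 1 - 2 * a| - τ)
      (fun a ha => le_trans (by norm_num) (hBge a (mem_sdiff.1 ha).1)) hb
    have h2 := hBge b (mem_sdiff.1 hb).1
    linarith
  have hsub : B ⊆ A := sdiff_eq_empty_iff_subset.1 hBA
  have hcard : #(A \ B) = k - 2 * q := by rw [card_sdiff_of_subset hsub, hk, hBcard]
  have hunion : A = B ∪ (A \ B) := (union_sdiff_of_subset hsub).symm
  by_cases hpar : k = 2 * q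
  · left
    have : A \ B = ∅ := card_eq_zero.1 (by omega)
    rw [this, union_empty] at hunion
    rw [hunion, hB, show (k + 1) / 2 = q by omega]
  · obtain ⟨a, ha⟩ := card_eq_one.1 (show #(A \ B) = 1 by omega)
    have haAB : a ∈ A \ B := ha ▸ mem_singleton_self a
    rw [ha, sum_singleton, hBA, sum_empty] at hslack
    have ham := mem_range.1 (hA (mem_sdiff.1 haAB).1)
    rw [ha] at hunion
    rw [show (k + 1) / 2 = q + 1 by omega, hunion, hB]
    rcases (hnB a (mem_sdiff.1 haAB).1 (mem_sdiff.1 haAB).2).2 (by omega) with rfl | rfl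
    · left
      ext b
      simp only [mem_union, mem_range, mem_Ico, mem_singleton]
      omega
    · right
      ext b
      simp only [mem_union, mem_range, mem_Ico, mem_singleton]
      omega

/-- The sum of the distances from `i` to the vertices of a path on `range m` with pendant vertices
attached at `A`. -/
def pathStatus (m : ℕ) (A : Finset ℕ) (i : ℕ) : ℤ :=
  ∑ j ∈ range m, |(i : ℤ) - j| + ∑ a ∈ A, (|(i : ℤ) - a| + 1)

theorem eq_ends_of_lt_pathStatus {m k : ℕ} {A : Finset ℕ} (hA : A ⊆ range m) (hk : #A = k)
    (hk0 : 0 < k) (hkm : k ≤ m)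
    (h : ∀ i < m, ((m : ℤ) + k) ^ 2 - 2 * k ^ 2 + 4 * k < 4 * pathStatus m A i + 4) :
    A = range ((k + 1) / 2) ∪ Ico (m - k / 2) m ∨ A = range (k / 2) ∪ Ico (m - (k + 1) / 2) m := by
  refine eq_ends_of_le_sum hA hk hkm ?_
  have h1 := h ((m - 1) / 2) (by omega)
  have h2 := h (m / 2) (by omega)
  have e1 := two_mul_sum_range_abs_of_lt (show (m - 1) / 2 < m by omega)
  have e2 := two_mul_sum_range_abs_of_lt (show m / 2 < m by omega)
  have e3 : ∑ a ∈ A, |(((m - 1) / 2 : ℕ) : ℤ) - a| + ∑ a ∈ A, |((m / 2 : ℕ) : ℤ) - a| =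
      ∑ a ∈ A, |(m : ℤ) - 1 - 2 * a| := by
    rw [← sum_add_distrib]
    refine sum_congr rfl fun a _ => ?_
    have := abs_cases ((((m - 1) / 2 : ℕ) : ℤ) - a)
    have := abs_cases (((m / 2 : ℕ) : ℤ) - a)
    have := abs_cases ((m : ℤ) - 1 - 2 * a)
    omega
  simp only [pathStatus, sum_add_distrib, sum_const, hk, nsmul_eq_mul, mul_one] at h1 h2
  rcases Nat.even_or_odd' m with ⟨r, rfl | rfl⟩
  · obtain ⟨s, rfl⟩ := Nat.exists_eq_add_of_lt (show 0 < r by omega)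
    rw [show (2 * (0 + s + 1) - 1) / 2 = s by omega] at *
    rw [show (2 * (0 + s + 1)) / 2 = s + 1 by omega] at *
    push_cast at *
    ring_nf at *
    omega
  · rw [show (2 * r + 1 - 1) / 2 = r by omega] at *
    rw [show (2 * r + 1) / 2 = r by omega] at *
    push_cast at *
    ring_nf at *
    omega

theorem lt_pathStatus_ends {m k i : ℕ} (hkm : k ≤ m) (hi : i < m) :
    ((m : ℤ) + k) ^ 2 - 2 * k ^ 2 + 4 * k <
      4 * pathStatus m (range ((k + 1) / 2) ∪ Ico (m - k / 2) m) i + 4 := by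
  have hdisj : Disjoint (range ((k + 1) / 2)) (Ico (m - k / 2) m) := by
    refine disjoint_left.2 fun a ha hb => ?_
    rw [mem_range] at ha
    rw [mem_Ico] at hb
    omega
  have e1 := two_mul_sum_range_abs_of_lt hi
  have e2 : ∑ a ∈ range ((k + 1) / 2), ((i : ℤ) - a) ≤ ∑ a ∈ range ((k + 1) / 2), |(i : ℤ) - a| :=
    sum_le_sum fun a _ => le_abs_self _
  have e3 : ∑ a ∈ Ico (m - k / 2) m, ((a : ℤ) - i) ≤ ∑ a ∈ Ico (m - k / 2) m, |(i : ℤ) - a| :=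
    sum_le_sum fun a _ => by rw [abs_sub_comm]; exact le_abs_self _
  have e4 := sum_range_id_int ((k + 1) / 2)
  have e5 := sum_Ico_id_int (show k / 2 ≤ m by omega)
  rw [pathStatus, sum_union hdisj, sum_add_distrib, sum_add_distrib]
  simp only [sum_sub_distrib, sum_const, card_range, Nat.card_Ico,
    Nat.sub_sub_self (show k / 2 ≤ m by omega), nsmul_eq_mul, mul_one] at e2 e3 ⊢
  obtain ⟨q, rfl | rfl⟩ := Nat.even_or_odd' k
  · rw [show (2 * q + 1) / 2 = q by omega, show 2 * q / 2 = q by omega] at *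
    push_cast at *
    nlinarith [sq_nonneg (2 * (i : ℤ) - (m - 1))]
  · rw [show (2 * q + 1 + 1) / 2 = q + 1 by omega, show (2 * q + 1) / 2 = q by omega] at *
    push_cast at *
    nlinarith [sq_nonneg (2 * (i : ℤ) - (m - 2))]

end EndsOfRange

namespace SimpleGraph

open Finset

theorem IsTree.four_mul_minStatus_le {V : Type*} [Fintype V] {T : SimpleGraph V} (hT : T.IsTree)
    {k m : ℕ} (hk : 3 ≤ k) (hkm : k ≤ m) (hm : m + k = Fintype.card V)
    (hsupp : k ≤ #T.supportVertices) :
    4 * (T.minStatus : ℤ) ≤ ((m : ℤ) + k) ^ 2 - 2 * k ^ 2 + 4 * k ∧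
      (((m : ℤ) + k) ^ 2 - 2 * k ^ 2 + 4 * k < 4 * (T.minStatus : ℤ) + 4 →
        ∃ A : Set (Fin m), Nonempty (T ≃g (pathGraph m).attachPendants A)) := by
  classical
  have := hT.connected.nonempty
  obtain ⟨x, hx⟩ := T.exists_status_eq_minStatus
  obtain ⟨p, h, hadj, hcases⟩ := hT.exists_parentMap x
  have hhalf : ∀ v, v ≠ x → 2 * #(descendants p v) ≤ Fintype.card V := fun v hv =>
    hT.two_mul_card_descendants_le h hadj (fun u => hx ▸ T.minStatus_le u) hv
  obtain ⟨K, hxK, hK, hinj, hKk⟩ :=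
    exists_leaves_of_parentMap h hadj hhalf (by omega) hsupp
  have key := h.four_mul_sum_depth_le hxK hK hinj hhalf (by omega) (by omega)
  rw [show ∑ w, T.dist x w = T.minStatus from hx, hKk, ← hm] at key
  push_cast at key
  refine ⟨key.1, fun hlt => ?_⟩
  obtain ⟨h2, h3⟩ := key.2 hlt
  exact hT.exists_iso_attachPendants h hadj hcases hxK hK hinj hhalf (by omega) (by omega)
    (by omega) (by omega)

theorem pathStatus_map_valEmbedding {m : ℕ} (A : Set (Fin m)) [Fintype A] (i : Fin m) :
    pathStatus m (A.toFinset.map Fin.valEmbedding) i =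
      ∑ j : Fin m, |(i : ℤ) - j| + ∑ a : A, (|(i : ℤ) - (a : Fin m)| + 1) := by
  rw [pathStatus, sum_map, ← Fin.sum_univ_eq_sum_range fun j => |((i : ℕ) : ℤ) - j|]
  congr 1
  rw [← Finset.sum_coe_sort, ← Equiv.sum_comp (Equiv.subtypeEquivRight fun _ => Set.mem_toFinset)]
  rfl

theorem mem_iff_of_map_eq {m : ℕ} {A : Set (Fin m)} [Fintype A] {B : Finset ℕ}
    (h : A.toFinset.map Fin.valEmbedding = B) (i : Fin m) : i ∈ A ↔ (i : ℕ) ∈ B := by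
  rw [← h, ← Set.mem_toFinset]
  exact (mem_map' Fin.valEmbedding).symm

/-- A path with pendant vertices of large minimum status is a caterpillar. -/
theorem mem_iff_of_lt_minStatus {m k : ℕ} {A : Set (Fin m)} [Fintype A] (hk0 : 0 < k)
    (hkm : k ≤ m) (hG : ((pathGraph m).attachPendants A).Connected) (hA : Fintype.card A = k)
    (h : ((m : ℤ) + k) ^ 2 - 2 * k ^ 2 + 4 * k <
      4 * (((pathGraph m).attachPendants A).minStatus : ℤ) + 4) :
    (∀ i, i ∈ A ↔ (i : ℕ) < (k + 1) / 2 ∨ m - k / 2 ≤ i) ∨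
      ∀ i, i ∈ A ↔ (i.rev : ℕ) < (k + 1) / 2 ∨ m - k / 2 ≤ i.rev := by
  have hsub : A.toFinset.map Fin.valEmbedding ⊆ range m := by
    intro a ha
    obtain ⟨i, -, rfl⟩ := mem_map.1 ha
    exact mem_range.2 i.2
  have hcard : #(A.toFinset.map Fin.valEmbedding) = k := by
    rw [card_map, Set.toFinset_card, hA]
  refine (eq_ends_of_lt_pathStatus hsub hcard hk0 hkm fun i hi => ?_).imp
    (fun e i => ?_) fun e i => ?_
  · have h1 := status_inl_le hG ⟨i, hi⟩
    rw [← pathStatus_map_valEmbedding] at h1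
    have h2 := ((pathGraph m).attachPendants A).minStatus_le (.inl ⟨i, hi⟩)
    simp only at h1
    omega
  · rw [mem_iff_of_map_eq e, mem_union, mem_range, mem_Ico]
    omega
  · rw [mem_iff_of_map_eq e, mem_union, mem_range, mem_Ico, Fin.val_rev]
    omega

/-- A lower bound for the minimum status of a caterpillar. -/
theorem lt_minStatus_of_mem_iff {m k : ℕ} {A : Set (Fin m)} [Fintype A] (hkm : k ≤ m)
    (hG : ((pathGraph m).attachPendants A).Connected)
    (hA : ∀ i, i ∈ A ↔ (i : ℕ) < (k + 1) / 2 ∨ m - k / 2 ≤ i) :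
    ((m : ℤ) + k) ^ 2 - 2 * k ^ 2 + 4 * k <
      4 * (((pathGraph m).attachPendants A).minStatus : ℤ) + 4 := by
  have := hG.nonempty
  obtain ⟨u, hu⟩ := ((pathGraph m).attachPendants A).exists_status_eq_minStatus
  obtain ⟨i, hi⟩ := exists_le_status hG u
  have hB : A.toFinset.map Fin.valEmbedding = range ((k + 1) / 2) ∪ Ico (m - k / 2) m := by
    ext a
    simp only [mem_map, Set.mem_toFinset, hA, mem_union, mem_range, mem_Ico]
    constructor
    · rintro ⟨j, hj, rfl⟩
      rw [Fin.valEmbedding_apply]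
      omega
    · intro ha
      exact ⟨⟨a, by omega⟩, by simp only; omega, rfl⟩
  rw [← pathStatus_map_valEmbedding, hB, hu] at hi
  have := lt_pathStatus_ends hkm i.2
  omega

end SimpleGraph

theorem mainTheorem5 {V : Type*} [Fintype V] (T : SimpleGraph V) (hT : T.IsTree) (n γ : ℕ)
    (hn : Fintype.card V = n) (hγ : T.dominationNumber = γ)
    (hlow : ⌈(n : ℚ) / 3⌉₊ < γ) (hupp : γ ≤ ⌊(n : ℚ) / 2⌋₊) :
    (T.minStatus : ℤ) ≤
        3 * (n : ℤ) * γ + 3 * γ - n - ⌈((n : ℚ) ^ 2 + 18 * (γ : ℚ) ^ 2) / 4⌉ ∧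
      ((T.minStatus : ℤ) =
          3 * (n : ℤ) * γ + 3 * γ - n - ⌈((n : ℚ) ^ 2 + 18 * (γ : ℚ) ^ 2) / 4⌉ ↔
        Nonempty (T ≃g SimpleGraph.caterpillar n ⌈(3 * (γ : ℚ) - n) / 2⌉₊
          ⌊(3 * (γ : ℚ) - n) / 2⌋₊)) := by
  have h1 : n + 3 ≤ 3 * γ := by
    have h2 := Nat.le_ceil ((n : ℚ) / 3)
    have h3 : ((⌈(n : ℚ) / 3⌉₊ : ℕ) : ℚ) + 1 ≤ γ := by exact_mod_cast hlow
    have h4 : (n : ℚ) + 3 ≤ 3 * γ := by linarith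
    exact_mod_cast h4
  have h2 : 2 * γ ≤ n := by
    rw [Nat.le_floor_iff (by positivity)] at hupp
    have h4 : 2 * (γ : ℚ) ≤ n := by linarith
    exact_mod_cast h4
  obtain ⟨k, hk⟩ := Nat.exists_eq_add_of_le (show n ≤ 3 * γ by omega)
  have hkq : 3 * (γ : ℚ) - n = k := by
    have : 3 * (γ : ℚ) = n + k := by exact_mod_cast hk
    linarith
  have hfloor : ⌊(3 * (γ : ℚ) - n) / 2⌋₊ = k / 2 := by
    rw [hkq]
    exact_mod_cast Nat.floor_div_eq_div (K := ℚ) k 2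
  have hceil : ⌈(3 * (γ : ℚ) - n) / 2⌉₊ = (k + 1) / 2 := by
    rw [hkq, Nat.ceil_eq_iff (by omega)]
    rcases Nat.even_or_odd' k with ⟨q, rfl | rfl⟩
    · rw [show (2 * q + 1) / 2 = q by omega, Nat.cast_sub (by omega)]
      push_cast
      constructor <;> linarith
    · rw [show (2 * q + 1 + 1) / 2 = q + 1 by omega, Nat.add_sub_cancel]
      push_cast
      constructor <;> linarith
  rw [hceil, hfloor]
  obtain ⟨m, hm⟩ : ∃ m, n - (k + 1) / 2 - k / 2 = m := ⟨_, rfl⟩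
  have hmk : m + k = n := by omega
  set c := ⌈((n : ℚ) ^ 2 + 18 * (γ : ℚ) ^ 2) / 4⌉ with hc
  have hc1 : (n : ℤ) ^ 2 + 18 * (γ : ℤ) ^ 2 ≤ 4 * c := by
    have := Int.le_ceil (((n : ℚ) ^ 2 + 18 * (γ : ℚ) ^ 2) / 4)
    rw [← hc] at this
    have h4 : (n : ℚ) ^ 2 + 18 * (γ : ℚ) ^ 2 ≤ 4 * c := by linarith
    exact_mod_cast h4
  have hc2 : 4 * c < (n : ℤ) ^ 2 + 18 * (γ : ℤ) ^ 2 + 4 := by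
    have := Int.ceil_lt_add_one (((n : ℚ) ^ 2 + 18 * (γ : ℚ) ^ 2) / 4)
    rw [← hc] at this
    have h4 : 4 * (c : ℚ) < (n : ℚ) ^ 2 + 18 * (γ : ℚ) ^ 2 + 4 := by linarith
    exact_mod_cast h4
  have hsq : (n : ℤ) ^ 2 + 18 * (γ : ℤ) ^ 2 = 3 * (m + k) ^ 2 + 4 * (m + k) * k + 2 * k ^ 2 := by
    have e1 : (n : ℤ) = m + k := by exact_mod_cast hmk.symm
    have e2 : 3 * (γ : ℤ) = m + k + k := by rw [← e1]; exact_mod_cast hk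
    rw [e1]
    linear_combination (6 * (γ : ℤ) + 2 * (m + k + k)) * e2
  have hprod : 4 * (3 * (n : ℤ) * γ + 3 * γ - n - c) =
      4 * (m + k) ^ 2 + 4 * (m + k) * k + 4 * k - 4 * c := by
    have e1 : (n : ℤ) = m + k := by exact_mod_cast hmk.symm
    have e2 : 3 * (γ : ℤ) = m + k + k := by rw [← e1]; exact_mod_cast hk
    rw [e1]
    linear_combination 4 * ((m : ℤ) + k + 1) * e2
  have hdom := hT.three_mul_dominationNumber_le (by omega)
  obtain ⟨hle, hiso⟩ := hT.four_mul_minStatus_le (k := k) (m := m) (by omega) (by omega)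
    (by omega) (by omega)
  set R := 3 * (n : ℤ) * γ + 3 * γ - n - c with hR
  have hR1 : 4 * R ≤ ((m : ℤ) + k) ^ 2 - 2 * k ^ 2 + 4 * k := by linarith
  have hR2 : ((m : ℤ) + k) ^ 2 - 2 * k ^ 2 + 4 * k < 4 * R + 4 := by linarith
  have heq : (T.minStatus : ℤ) = R ↔
      ((m : ℤ) + k) ^ 2 - 2 * k ^ 2 + 4 * k < 4 * (T.minStatus : ℤ) + 4 := by omega
  refine ⟨by omega, ?_⟩
  classical
  rw [heq]
  subst hm
  have hfeet : ∀ i, i ∈ SimpleGraph.caterpillarFeet n ((k + 1) / 2) (k / 2) ↔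
      (i : ℕ) < (k + 1) / 2 ∨ n - (k + 1) / 2 - k / 2 - k / 2 ≤ i := by
    intro i
    rw [SimpleGraph.caterpillarFeet, Set.mem_ofPred_eq]
    omega
  constructor
  · intro hlt
    obtain ⟨A, ⟨e⟩⟩ := hiso hlt
    have hcard : Fintype.card A = k := by
      have := Fintype.card_congr e.toEquiv
      rw [Fintype.card_sum, Fintype.card_fin] at this
      omega
    rw [e.minStatus_eq] at hlt
    rcases SimpleGraph.mem_iff_of_lt_minStatus (by omega) (by omega)
      (e.connected_iff.1 hT.connected) hcard hlt with hA | hA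
    · exact ⟨e.trans (SimpleGraph.attachPendantsCongr (SimpleGraph.Iso.refl) fun i =>
        (hA i).trans (hfeet i).symm)⟩
    · exact ⟨e.trans (SimpleGraph.attachPendantsCongr (SimpleGraph.pathGraphRev _) fun i =>
        (hA i).trans (hfeet _).symm)⟩
  · rintro ⟨e⟩
    rw [e.minStatus_eq]
    exact SimpleGraph.lt_minStatus_of_mem_iff (by omega) (e.connected_iff.1 hT.connected) hfeet
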